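/- Consider a sequence of problems indexed by $t\in\mathbb N$; all quantities below may depend on $t$ (the index is suppressed), except $k,\sigma_x,c_{\min},c_{\max},\nu$ and the constants named $c_\lambda,C_\lambda,c_\mu,C_\mu,\kappa$. Let $\mathcal G$ be a simple undirected graph on $\{1,\dots,n\}$ with maximum degree $d\ge 2$, where $n\to\infty$. Let $F$ be its oriented incidence matrix (the row of an edge $\{i,j\}$, $i<j$, has $-1$ at $i$, $+1$ at $j$ and $0$ elsewhere), and for an integer $k\ge 0$ let $\Delta^{(k+1)}$ be the graph difference operator of order $k+1$: $\Delta^{(1)}=F$, $\Delta^{(k+1)}=F^T\Delta^{(k)}$ for odd $k$ and $\Delta^{(k+1)}=F\Delta^{(k)}$ for even $k\ge2$. Let $y=X\beta^*+\varepsilon$ with $X\in\mathbb R^{N\times n}$, $N\ge 1$, where - $\beta^*\in\mathbb R^n$ is deterministic, $\|\Delta^{(k+1)}\beta^*\|_0\le s_1$, $\|\beta^*\|_0\le s_2$, with integers $s_1,s_2\ge1$ and $s_2/s_1\ge\nu$ for a constant $0\le\nu<1$; - the rows of $X$ are i.i.d. $\sigma_x$-sub-Gaussian (mean zero, and $\mathbb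 E e^{\tau u^TX_i}\le e^{\sigma_x^2\tau^2/2}$ for all unit vectors $u$ and real $\tau$), with covariance matrix $\Sigma_x$ whose eigenvalues lie in $[c_{\min},c_{\max}]$, $c_{\min}>0$; put $\Theta_x=\Sigma_x^{-1}$ and let $M_n$ bound its largest absolute row sum; - $\varepsilon\sim N(0,\sigma_\varepsilon^2I_N)$, $\sigma_\varepsilon>0$, is independent of $X$. Write $\Sigma_N=X^TX/N$, and let $\|\cdot\|_\infty$ be the largest absolute value of an entry of a vector or matrix. Let $\hat\beta$ be any minimizer of $\frac1{2N}\|y-X\beta\|_2^2+\lambda_g\|\Delta^{(k+1)}\beta\|_1+\lambda\|\beta\|_1$ over $\beta\in\mathbb R^n$. Let $\widehat\Theta$ be a measurable function of $X$ that minimizes $\sum_{i,j}|\Theta_{ij}|$ over the $\Theta\in\mathbb R^{n\times n}$ with $\|\Theta\Sigma_N-I_n\|_\infty\le\mu$ whenever such $\Theta$ exist. Put $\tilde\beta=\hat\beta+\frac1N\widehat\Theta X^T(y-X\hat\beta)$. There are constants $c_\lambda,c_\mu,\kappa>0$ depending only on $\sigma_x,c_{\min},c_{\max},\nu$ such that the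 following holds whenever, for some constants $C_\lambda,C_\mu$, $$c_\lambda\sigma_\varepsilon\sqrt{\tfrac{\log n}{N}}\le\lambda\le C_\lambda\sigma_\varepsilon\sqrt{\tfrac{\log n}{N}},\qquad \lambda_g=\lambda\sqrt{\tfrac{\nu}{(2d)^{k+1}}},\qquad c_\mu\sqrt{\tfrac{\log n}{N}}\le\mu\le C_\mu\sqrt{\tfrac{\log n}{N}} .$$ 1. $\sqrt N(\Delta^{(k+1)}\tilde\beta-\Delta^{(k+1)}\beta^*)=\Psi^{(k+1)}-e^{(k+1)}$, where $\Psi^{(k+1)}=\frac1{\sqrt N}\Delta^{(k+1)}\widehat\Theta X^T\varepsilon$ and $e^{(k+1)}=\sqrt N\,\Delta^{(k+1)}(\widehat\Theta\Sigma_N-I_n)(\hat\beta-\beta^*)$. 2. The conditional law of $\Psi^{(k+1)}$ given $X$ is $N\big(0,\ \sigma_\varepsilon^2\,\Delta^{(k+1)}\widehat\Theta\Sigma_N\widehat\Theta^T(\Delta^{(k+1)})^T\big)$. 3. If $N\ge\kappa\, s_2\log n$ for all large $t$, then $\|e^{(k+1)}\|_\infty=\mathcal O_{\mathbb P}\Big(\sigma_\varepsilon(2d)^{\frac{k+1}2}\frac{s_2\log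 n}{\sqrt N}\Big)$. 4. $\big\|\Delta^{(k+1)}\widehat\Theta\Sigma_N\widehat\Theta^T(\Delta^{(k+1)})^T-\Delta^{(k+1)}\Theta_x(\Delta^{(k+1)})^T\big\|_\infty=\mathcal O_{\mathbb P}\Big((2d)^{k+1}M_n\sqrt{\tfrac{\log n}{N}}\Big)$. Here $Y_t=\mathcal O_{\mathbb P}(a_t)$ means that for each $\delta>0$ there is $K>0$ with $\mathbb P(|Y_t|>Ka_t)\le\delta$ for all large $t$. -/

import Mathlib

open MeasureTheory ProbabilityTheory Filter Matrix

namespace GPPL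

noncomputable section

/-! ### Matrices and norms -/

/-- The (product) Borel σ-algebra on real matrices. -/
instance instMeasurableSpaceMatrix {m n : Type*} : MeasurableSpace (Matrix m n ℝ) :=
  inferInstanceAs (MeasurableSpace (m → n → ℝ))

/-- The number of nonzero entries of a vector, `‖v‖₀`. -/
def l0 {ι : Type*} (v : ι → ℝ) : ℕ := {i | v i ≠ 0}.ncard

/-- The `ℓ₁`-norm of a vector. -/
def l1 {ι : Type*} [Fintype ι] (v : ι → ℝ) : ℝ := ∑ i, |v i|

/-- The largest absolute value of an entry of a vector (`0` for the empty vector). -/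
def vecMax {ι : Type*} (v : ι → ℝ) : ℝ := ⨆ i, |v i|

/-- The element-wise `ℓ₁`-norm `‖M‖_{1,1}` of a matrix. -/
def l11 {m n : Type*} [Fintype m] [Fintype n] (M : Matrix m n ℝ) : ℝ := ∑ i, ∑ j, |M i j|

/-- The element-wise infinity norm of a matrix: the largest absolute value of an entry. -/
def matMax {m n : Type*} (M : Matrix m n ℝ) : ℝ := ⨆ i, ⨆ j, |M i j|

/-- The `ℓ_∞`-operator norm of a matrix: the largest absolute row sum. -/
def opInf {m n : Type*} [Fintype n] (M : Matrix m n ℝ) : ℝ := ⨆ i, ∑ j, |M i j|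

/-! ### Graph difference operators -/

section Graph

variable {n : ℕ} (G : SimpleGraph (Fin n))

/-- The oriented incidence matrix `F`, with rows indexed by the edges: the row of an edge `{i, j}`
with `i < j` has the entry `-1` at `i`, the entry `+1` at `j`, and zeros elsewhere. -/
def incidence : Matrix G.edgeSet (Fin n) ℝ :=
  fun e v => if v = e.1.inf then -1 else if v = e.1.sup then 1 else 0

/-- The index type of the rows of the graph difference operator of order `k + 1`:
the edges for even `k`, the vertices for odd `k`. -/
def DiffRow : ℕ → Type
  | 0 => G.edgeSet
  | 1 => Fin n
  | k + 2 => DiffRow k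

instance instFintypeDiffRow [DecidableRel G.Adj] : ∀ k, Fintype (DiffRow G k)
  | 0 => inferInstanceAs (Fintype G.edgeSet)
  | 1 => inferInstanceAs (Fintype (Fin n))
  | k + 2 => instFintypeDiffRow k

instance instDecidableEqDiffRow : ∀ k, DecidableEq (DiffRow G k)
  | 0 => inferInstanceAs (DecidableEq G.edgeSet)
  | 1 => inferInstanceAs (DecidableEq (Fin n))
  | k + 2 => instDecidableEqDiffRow k

/-- The matrix by which the operator of order `k + 1` is multiplied on the left to give the
operator of order `k + 2`: it is `Fᵀ` for even `k` and `F` for odd `k`. -/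
def diffStep : ∀ k, Matrix (DiffRow G (k + 1)) (DiffRow G k) ℝ
  | 0 => (incidence G)ᵀ
  | 1 => incidence G
  | k + 2 => diffStep k

/-- The graph difference operator of order `k + 1`: `diffOp G k` is `Δ^{(k+1)}`, so that
`Δ^{(1)} = F`, `Δ^{(2)} = Fᵀ F`, `Δ^{(3)} = F Fᵀ F`, and so on. -/
def diffOp [DecidableRel G.Adj] : ∀ k, Matrix (DiffRow G k) (Fin n) ℝ
  | 0 => incidence G
  | k + 1 => diffStep G k * diffOp k

end Graph

/-! ### Sub-Gaussian variables and designs, stochastic boundedness -/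

/-- A real random variable is `σ`-sub-Gaussian if it has mean zero and its moment generating
function is finite and at most `exp (σ² t² / 2)` for all real `t`. -/
def IsSubGaussian {Ω : Type*} [MeasurableSpace Ω] (P : Measure Ω) (Z : Ω → ℝ) (σ : ℝ) : Prop :=
  ∫ ω, Z ω ∂P = 0 ∧ HasSubgaussianMGF Z (σ ^ 2).toNNReal P

/-- `X` is a row-wise `(σ, S)`-sub-Gaussian random matrix: its rows are i.i.d., centred, have
covariance matrix `S`, and every unit-norm linear combination of the entries of a row is
`σ`-sub-Gaussian. -/
structure IsSubGaussianDesign {Ω : Type*} [MeasurableSpace Ω] (P : Measure Ω) {N n : ℕ}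
    (X : Ω → Matrix (Fin N) (Fin n) ℝ) (σ : ℝ) (S : Matrix (Fin n) (Fin n) ℝ) : Prop where
  measurable : Measurable X
  indep : iIndepFun (fun (i : Fin N) (ω : Ω) => X ω i) P
  ident : ∀ i j, IdentDistrib (fun ω => X ω i) (fun ω => X ω j) P P
  mean : ∀ i a, ∫ ω, X ω i a ∂P = 0
  subGaussian : ∀ i (u : Fin n → ℝ), u ⬝ᵥ u = 1 → IsSubGaussian P (fun ω => u ⬝ᵥ X ω i) σ
  cov : ∀ i a b, covariance (fun ω => X ω i a) (fun ω => X ω i b) P = S a b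

/-- `Y_t = O_P(a_t)` as `t → ∞`: the ratios `Y_t / a_t` are stochastically bounded. -/
def IsBigOInProb {Ω : ℕ → Type*} [∀ t, MeasurableSpace (Ω t)] (P : ∀ t, Measure (Ω t))
    (Y : ∀ t, Ω t → ℝ) (a : ℕ → ℝ) : Prop :=
  ∀ δ : ℝ, 0 < δ → ∃ K : ℝ, 0 < K ∧
    ∀ᶠ t in atTop, P t {ω | K * a t < |Y t ω|} ≤ ENNReal.ofReal δ

/-! ### The estimators -/

section Estimators

variable {N n : ℕ}

/-- The sample second-moment matrix `Σ_N = Xᵀ X / N`. -/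
def sampleGram (X : Matrix (Fin N) (Fin n) ℝ) : Matrix (Fin n) (Fin n) ℝ :=
  (1 / (N : ℝ)) • (Xᵀ * X)

/-- The response `y = X β + ε` of the linear model. -/
def response (X : Matrix (Fin N) (Fin n) ℝ) (β : Fin n → ℝ) (ε : Fin N → ℝ) : Fin N → ℝ :=
  X *ᵥ β + ε

/-- The objective `‖y - X β‖₂² / (2 N) + lamG ‖Δ β‖₁ + lam ‖β‖₁`. -/
def objective {m : Type*} [Fintype m] (D : Matrix m (Fin n) ℝ) (lamG lam : ℝ)
    (X : Matrix (Fin N) (Fin n) ℝ) (y : Fin N → ℝ) (β : Fin n → ℝ) : ℝ :=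
  1 / (2 * (N : ℝ)) * ∑ i, (y i - (X *ᵥ β) i) ^ 2 + lamG * l1 (D *ᵥ β) + lam * l1 β

/-- `β` is a `k`-th order Graph-Piecewise-Polynomial-Lasso estimate: a minimizer of the
objective with `Δ = Δ^{(k+1)}`. -/
def IsGraphLasso (G : SimpleGraph (Fin n)) [DecidableRel G.Adj] (k : ℕ) (lamG lam : ℝ)
    (X : Matrix (Fin N) (Fin n) ℝ) (y : Fin N → ℝ) (β : Fin n → ℝ) : Prop :=
  ∀ b, objective (diffOp G k) lamG lam X y β ≤ objective (diffOp G k) lamG lam X y b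

/-- The constraint `‖Θ S - I‖_∞ ≤ μ` (element-wise) of the CLIME program. -/
def ClimeFeasible (S : Matrix (Fin n) (Fin n) ℝ) (μ : ℝ) (Θ : Matrix (Fin n) (Fin n) ℝ) : Prop :=
  matMax (Θ * S - 1) ≤ μ

/-- `Θ` solves the CLIME program: it minimizes `‖Θ‖_{1,1}` subject to the constraint. -/
def IsClime (S : Matrix (Fin n) (Fin n) ℝ) (μ : ℝ) (Θ : Matrix (Fin n) (Fin n) ℝ) : Prop :=
  ClimeFeasible S μ Θ ∧ ∀ Θ', ClimeFeasible S μ Θ' → l11 Θ ≤ l11 Θ'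

/-- The one-step estimator `β + Θ Xᵀ (y - X β) / N`. -/
def oneStep (Θ : Matrix (Fin n) (Fin n) ℝ) (X : Matrix (Fin N) (Fin n) ℝ) (y : Fin N → ℝ)
    (β : Fin n → ℝ) : Fin n → ℝ :=
  β + (1 / (N : ℝ)) • ((Θ * Xᵀ) *ᵥ (y - X *ᵥ β))

/-- The noise term `Δ Θ Xᵀ ε / √N`. -/
def noiseTerm {m : Type*} (D : Matrix m (Fin n) ℝ) (Θ : Matrix (Fin n) (Fin n) ℝ)
    (X : Matrix (Fin N) (Fin n) ℝ) (ε : Fin N → ℝ) : m → ℝ :=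
  (1 / √(N : ℝ)) • ((D * Θ * Xᵀ) *ᵥ ε)

/-- The remainder `√N Δ (Θ Σ_N - I) (β - β*)`. -/
def remainder {m : Type*} (D : Matrix m (Fin n) ℝ) (Θ : Matrix (Fin n) (Fin n) ℝ)
    (X : Matrix (Fin N) (Fin n) ℝ) (β βstar : Fin n → ℝ) : m → ℝ :=
  √(N : ℝ) • ((D * (Θ * sampleGram X - 1)) *ᵥ (β - βstar))

/-- The sandwich covariance matrix `Δ Θ Σ_N Θᵀ Δᵀ`. -/
def sandwich {m : Type*} (D : Matrix m (Fin n) ℝ) (Θ : Matrix (Fin n) (Fin n) ℝ)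
    (X : Matrix (Fin N) (Fin n) ℝ) : Matrix m m ℝ :=
  D * Θ * sampleGram X * Θᵀ * Dᵀ

end Estimators

end

end GPPL

open GPPL

/-! The decomposition is pure algebra. The law of the noise term comes from freezing the design: `X`
and `ε` are independent, so given `X = x` the noise term is a fixed linear image of a Gaussian
vector (`condDistrib_comp_of_indepFun`, `map_mulVec_pi_gaussianReal`).

The remainder is at most `√N` times the largest absolute row sum of `Δ`, times `μ`, times `‖β̂ -
β*‖₁` (`vecMax_remainder_le`). Rows of `F` have absolute sum at most `2` and columns at most `d`,
whence `(2d)^((k+1)/2)` for the row sums of `Δ`. The `ℓ₁`-error has the Lasso rate `λ s₂`. Indeed,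
put `v = β̂ - β*` and compare the objective at `β̂` and `β*`. The Schur test bounds the `ℓ₂`-norm of
`Δ` by `(2d)^((k+1)/2)`, the scaling of `λ_g` cancels this factor, and `ν s₁ ≤ s₂` then makes the
graph penalty cost at most `λ √s₂ ‖v‖₂`. So `v` lies in the cone `‖v‖₁ ≤ 6 √s₂ ‖v‖₂`
(`lasso_basic_inequality`). On this cone the form of `Σ_N` is bounded below by Maurey's empirical
method: a lower bound on all sums of `m` signed basis vectors extends to every vector, up to a
multiple of `‖v‖₁² / m` (`l1_sq_lower_bound_of_forall_signedSum`). With `m` of order `s₂` there are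
only `(2n)^m` such sums, and a union bound works as soon as `N` exceeds a multiple of `s₂ log n`.

For the sandwich, the CLIME program splits into rows, so feasibility of `Θ_x` forces the rows of
`Θ̂` to have `ℓ₁`-norm at most `M_n`. The error is then a sum of three products of a matrix with
entries at most `μ` and a matrix with row sums at most `M_n` (`IsClime.abs_sandwich_sub_le`).
Feasibility of `Θ_x` follows from concentration of quadratic forms by polarization. No lower bound
on `N` is available here, but if concentration fails because `N` is small then `μ ≥ 1`, the
estimator is `Θ̂ = 0`, and the bound is trivial. -/

namespace GPPL

/-! ### Row sums, column sums and the Schur test -/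

section Schur

variable {l m n : Type*} [Fintype m] [Fintype n]

/-- Cauchy-Schwarz in each row with weights `|A i j|` produces the row sums; exchanging the order of
summation produces the column sums. -/
theorem sum_sq_mulVec_le_of_row_col (A : Matrix m n ℝ) {r c : ℝ} (hr0 : 0 ≤ r)
    (hr : ∀ i, ∑ j, |A i j| ≤ r) (hc : ∀ j, ∑ i, |A i j| ≤ c) (v : n → ℝ) :
    ∑ i, (A *ᵥ v) i ^ 2 ≤ r * c * ∑ j, v j ^ 2 := by
  have key : ∀ i, (A *ᵥ v) i ^ 2 ≤ r * ∑ j, |A i j| * v j ^ 2 := by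
    intro i
    have h1 : (A *ᵥ v) i ^ 2 ≤ (∑ j, |A i j|) * ∑ j, |A i j| * v j ^ 2 := by
      refine Finset.sum_sq_le_sum_mul_sum_of_sq_le_mul _ (fun j _ => abs_nonneg _)
        (fun j _ => by positivity) (fun j _ => ?_)
      rw [mul_pow, ← sq_abs (A i j)]; exact le_of_eq (by ring)
    exact h1.trans (mul_le_mul_of_nonneg_right (hr i)
      (Finset.sum_nonneg fun j _ => by positivity))
  calc ∑ i, (A *ᵥ v) i ^ 2 ≤ ∑ i, r * ∑ j, |A i j| * v j ^ 2 :=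
        Finset.sum_le_sum fun i _ => key i
    _ = r * ∑ j, (∑ i, |A i j|) * v j ^ 2 := by
        rw [← Finset.mul_sum, Finset.sum_comm]
        simp_rw [Finset.sum_mul]
    _ ≤ r * ∑ j, c * v j ^ 2 := by
        gcongr with j _
        exact hc j
    _ = r * c * ∑ j, v j ^ 2 := by rw [← Finset.mul_sum, mul_assoc]

theorem row_sum_mul_le (A : Matrix l m ℝ) (B : Matrix m n ℝ) {a b : ℝ} (hb0 : 0 ≤ b)
    (hA : ∀ i, ∑ j, |A i j| ≤ a) (hB : ∀ i, ∑ j, |B i j| ≤ b) (i : l) :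
    ∑ j, |(A * B) i j| ≤ a * b := by
  calc ∑ j, |(A * B) i j| ≤ ∑ j, ∑ k, |A i k| * |B k j| := by
        refine Finset.sum_le_sum fun j _ => ?_
        rw [Matrix.mul_apply]
        refine (Finset.abs_sum_le_sum_abs _ _).trans_eq ?_
        simp_rw [abs_mul]
    _ = ∑ k, |A i k| * ∑ j, |B k j| := by
        rw [Finset.sum_comm]; simp_rw [Finset.mul_sum]
    _ ≤ ∑ k, |A i k| * b := by gcongr with k _; exact hB k
    _ = (∑ k, |A i k|) * b := by rw [Finset.sum_mul]
    _ ≤ a * b := by gcongr; exact hA i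

end Schur

/-! ### Bounds on graph difference operators -/

section Graph

variable {n : ℕ} (G : SimpleGraph (Fin n))

theorem abs_incidence (e : G.edgeSet) (v : Fin n) :
    |incidence G e v| = if v ∈ e.1 then 1 else 0 := by
  obtain ⟨e, he⟩ := e
  induction e using Sym2.ind with
  | _ a b =>
    simp only [incidence, Sym2.inf_mk, Sym2.sup_mk, Sym2.mem_iff]
    rcases le_total a b with h | h
    · simp only [inf_eq_left.2 h, sup_eq_right.2 h]
      split_ifs <;> simp_all
    · simp only [inf_eq_right.2 h, sup_eq_left.2 h]
      split_ifs <;> simp_all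

theorem incidence_row_sum_le (e : G.edgeSet) : ∑ v, |incidence G e v| ≤ 2 := by
  simp_rw [abs_incidence]
  rw [Finset.sum_boole]
  obtain ⟨e, he⟩ := e
  induction e using Sym2.ind with
  | _ a b =>
    have : (Finset.univ.filter fun v => v ∈ s(a, b)) ⊆ {a, b} := by
      intro v; simp [Sym2.mem_iff]
    exact_mod_cast (Finset.card_le_card this).trans Finset.card_le_two

variable [DecidableRel G.Adj]

theorem incidence_col_sum_le (v : Fin n) :
    ∑ e, |incidence G e v| ≤ (G.maxDegree : ℝ) := by
  simp_rw [abs_incidence]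
  rw [Finset.sum_boole]
  have h : (Finset.univ.filter fun e : G.edgeSet => v ∈ e.1).card ≤ (G.incidenceFinset v).card := by
    refine Finset.card_le_card_of_injOn (fun e => e.1) ?_ (Subtype.val_injective.injOn)
    intro e he
    have he' : v ∈ e.1 := by simpa using he
    exact Finset.mem_coe.2 ((G.mem_incidenceFinset v e.1).2 ⟨e.2, he'⟩)
  rw [SimpleGraph.card_incidenceFinset_eq_degree] at h
  exact_mod_cast h.trans (G.degree_le_maxDegree v)

/-- Consecutive steps are transposes of each other, so `r` and `c` swap roles. The pair is `(d, 2)`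
or `(2, d)` according to parity; only the product matters later. -/
theorem diffStep_row_col_sum_le : ∀ k, ∃ r c : ℝ, 0 ≤ r ∧ 0 ≤ c ∧ r * c = 2 * G.maxDegree ∧
    (∀ i, ∑ j, |diffStep G k i j| ≤ r) ∧ (∀ j, ∑ i, |diffStep G k i j| ≤ c) ∧
    (∀ i, ∑ j, |diffStep G (k + 1) i j| ≤ c) ∧ (∀ j, ∑ i, |diffStep G (k + 1) i j| ≤ r)
  | 0 => ⟨G.maxDegree, 2, by positivity, by positivity, by ring,
      incidence_col_sum_le G, incidence_row_sum_le G,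
      incidence_row_sum_le G, incidence_col_sum_le G⟩
  | 1 => ⟨2, G.maxDegree, by positivity, by positivity, by ring,
      incidence_row_sum_le G, incidence_col_sum_le G,
      incidence_col_sum_le G, incidence_row_sum_le G⟩
  | k + 2 => diffStep_row_col_sum_le k

theorem sum_sq_diffOp_mulVec_le (v : Fin n → ℝ) : ∀ k,
    ∑ i, (diffOp G k *ᵥ v) i ^ 2 ≤ (2 * (G.maxDegree : ℝ)) ^ (k + 1) * ∑ j, v j ^ 2
  | 0 => by
      have := sum_sq_mulVec_le_of_row_col (incidence G) (by norm_num)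
        (incidence_row_sum_le G) (incidence_col_sum_le G) v
      rw [zero_add, pow_one]
      exact this
  | k + 1 => by
      obtain ⟨r, c, hr, hc, hrc, h1, h2, -, -⟩ := diffStep_row_col_sum_le G k
      have := sum_sq_mulVec_le_of_row_col (diffStep G k) hr h1 h2 (diffOp G k *ᵥ v)
      rw [mulVec_mulVec, hrc] at this
      refine this.trans ?_
      rw [pow_succ' _ (k + 1), mul_assoc (2 * (G.maxDegree : ℝ)) (_ ^ _)]
      exact mul_le_mul_of_nonneg_left (sum_sq_diffOp_mulVec_le v k) (by positivity)

/-- The induction advances two orders at a time: a single step may multiply row sums by `d`, which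
can exceed `√(2d)`, while two steps together cost exactly `2d`. The base case `2 ≤ √(2d)` is where
`d ≥ 2` is needed. -/
theorem diffOp_row_sum_le (hd : 2 ≤ G.maxDegree) : ∀ k i,
    ∑ j, |diffOp G k i j| ≤ √((2 * (G.maxDegree : ℝ)) ^ (k + 1))
  | 0, i => by
      refine (incidence_row_sum_le G i).trans (Real.le_sqrt_of_sq_le ?_)
      have : (2 : ℝ) ≤ G.maxDegree := by exact_mod_cast hd
      norm_num; linarith
  | 1, i => by
      rw [Real.sqrt_sq (by positivity), mul_comm]
      exact row_sum_mul_le (incidence G)ᵀ (incidence G) (by norm_num)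
        (incidence_col_sum_le G) (incidence_row_sum_le G) i
  | k + 2, i => by
      obtain ⟨r, c, hr, hc, hrc, h1, h2, h3, h4⟩ := diffStep_row_col_sum_le G k
      have e : √((2 * (G.maxDegree : ℝ)) ^ (k + 2 + 1)) =
          c * (r * √((2 * (G.maxDegree : ℝ)) ^ (k + 1))) := by
        rw [show k + 2 + 1 = (k + 1) + 2 by ring, pow_add, Real.sqrt_mul (by positivity),
          Real.sqrt_sq (by positivity), ← hrc]
        ring
      rw [e]
      exact row_sum_mul_le (diffStep G (k + 1)) (diffStep G k * diffOp G k) (by positivity) h3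
        (row_sum_mul_le _ _ (by positivity) h1 (diffOp_row_sum_le hd k)) i

end Graph

/-! ### Restricted eigenvalues from sparse integer vectors -/

section Transfer

variable {ι : Type*} [DecidableEq ι]

/-- The standard basis vector at `p.1`, with the sign given by `p.2`. -/
noncomputable def signedBasis (p : ι × Bool) : ι → ℝ := Pi.single p.1 (if p.2 then 1 else -1)

/-- The sum of a finite family of signed standard basis vectors. -/
noncomputable def signedSum {m : ℕ} (f : Fin m → ι × Bool) : ι → ℝ := ∑ l, signedBasis (f l)

theorem quadForm_add {κ : Type*} [Fintype κ] {A : Matrix κ κ ℝ} (hA : Aᵀ = A) (u v : κ → ℝ) :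
    (u + v) ⬝ᵥ A *ᵥ (u + v) = u ⬝ᵥ A *ᵥ u + 2 * (v ⬝ᵥ A *ᵥ u) + v ⬝ᵥ A *ᵥ v := by
  have h : u ⬝ᵥ A *ᵥ v = v ⬝ᵥ A *ᵥ u := by
    rw [dotProduct_mulVec, ← mulVec_transpose, hA, dotProduct_comm]
  rw [mulVec_add, add_dotProduct, dotProduct_add, dotProduct_add, h]
  ring

variable [Fintype ι]

/-- Since `l1 v = 1`, `v` is the mean of the random signed basis vector that picks `j` with
probability `|v j|` and the sign of `v j`. Averaging the hypothesis over it gives the form at `u +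
v` plus a variance term `∑ |v j| A j j - v ⬝ᵥ A *ᵥ v`, and the diagonal is at most `C`. -/
theorem le_quadForm_add_of_forall_signedBasis {A : Matrix ι ι ℝ} (hA : Aᵀ = A) {C B : ℝ}
    (hC : ∀ j, A j j ≤ C) {u v : ι → ℝ} (hv : l1 v = 1)
    (h : ∀ p : ι × Bool, B ≤ (u + signedBasis p) ⬝ᵥ A *ᵥ (u + signedBasis p)) :
    B ≤ (u + v) ⬝ᵥ A *ᵥ (u + v) + (C - v ⬝ᵥ A *ᵥ v) := by
  have key : ∀ j, |v j| * B ≤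
      |v j| * (u ⬝ᵥ A *ᵥ u) + 2 * (v j * (A *ᵥ u) j) + |v j| * C := by
    intro j
    have h1 := h (j, decide (0 ≤ v j))
    rw [quadForm_add hA] at h1
    have e1 : signedBasis (j, decide (0 ≤ v j)) ⬝ᵥ A *ᵥ u =
        (if 0 ≤ v j then 1 else -1) * (A *ᵥ u) j := by
      simp [signedBasis]
    have e2 : signedBasis (j, decide (0 ≤ v j)) ⬝ᵥ A *ᵥ signedBasis (j, decide (0 ≤ v j)) =
        A j j := by
      simp only [signedBasis, single_dotProduct, mulVec_single]
      split_ifs <;> simp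
    rw [e1, e2] at h1
    have e3 : |v j| * (if 0 ≤ v j then 1 else -1) = v j := by
      split_ifs with h0
      · rw [abs_of_nonneg h0, mul_one]
      · rw [abs_of_neg (not_le.1 h0)]; ring
    have h2 := mul_le_mul_of_nonneg_left (h1.trans (add_le_add_right (hC j) _)) (abs_nonneg (v j))
    linear_combination h2 + 2 * (A *ᵥ u) j * e3
  have hs := Finset.sum_le_sum fun j (_ : j ∈ Finset.univ) => key j
  rw [Finset.sum_add_distrib, Finset.sum_add_distrib, ← Finset.mul_sum, ← Finset.sum_mul,
    ← Finset.sum_mul, ← Finset.sum_mul] at hs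
  change l1 v * B ≤ l1 v * _ + 2 * (v ⬝ᵥ A *ᵥ u) + l1 v * C at hs
  rw [hv] at hs
  rw [quadForm_add hA]
  linarith

/-- The `m` random summands are replaced by their mean one at a time, each at the price of one
variance term. The base point `u` is general so that the induction can absorb a summand. -/
theorem le_quadForm_add_smul_of_forall_signedSum {A : Matrix ι ι ℝ} (hA : Aᵀ = A) {C B : ℝ}
    (hC : ∀ j, A j j ≤ C) {v : ι → ℝ} (hv : l1 v = 1) :
    ∀ (m : ℕ) (u : ι → ℝ),
      (∀ f : Fin m → ι × Bool, B ≤ (u + signedSum f) ⬝ᵥ A *ᵥ (u + signedSum f)) →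
      B ≤ (u + (m : ℝ) • v) ⬝ᵥ A *ᵥ (u + (m : ℝ) • v) + m * (C - v ⬝ᵥ A *ᵥ v)
  | 0, u, h => by simpa [signedSum] using h Fin.elim0
  | m + 1, u, h => by
      have := le_quadForm_add_of_forall_signedBasis (B := B - m * (C - v ⬝ᵥ A *ᵥ v)) hA hC
        (u := u + (m : ℝ) • v) hv (fun p => by
          have := le_quadForm_add_smul_of_forall_signedSum hA hC hv m (u + signedBasis p)
            (fun f => by
              have := h (Fin.cons p f)
              rwa [signedSum, Fin.sum_univ_succ, Fin.cons_zero, ← add_assoc] at this)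
          rw [add_right_comm]
          linarith)
      rw [add_assoc, show (m : ℝ) • v + v = ((m + 1 : ℕ) : ℝ) • v by push_cast; module] at this
      push_cast at this ⊢
      linarith

/-- If a quadratic form is nonnegative on all sums of `m` signed basis vectors, then it is
bounded below on all of `ι → ℝ` by a multiple of the squared `ℓ₁`-norm. -/
theorem neg_l1_sq_le_quadForm_of_forall_signedSum {A : Matrix ι ι ℝ} (hA : Aᵀ = A) {C : ℝ}
    (hC : ∀ j, A j j ≤ C) {m : ℕ} (hm : 0 < m)
    (h : ∀ f : Fin m → ι × Bool, 0 ≤ signedSum f ⬝ᵥ A *ᵥ signedSum f) (v : ι → ℝ) :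
    0 ≤ ((m : ℝ) - 1) * (v ⬝ᵥ A *ᵥ v) + C * l1 v ^ 2 := by
  have hm' : (0 : ℝ) < m := by exact_mod_cast hm
  by_cases h0 : l1 v = 0
  · have hv : v = 0 := by
      ext i
      have := (Finset.sum_eq_zero_iff_of_nonneg (fun i _ => abs_nonneg (v i))).1 h0 i
        (Finset.mem_univ i)
      simpa using this
    simp [hv, l1]
  have hpos : 0 < l1 v := lt_of_le_of_ne (Finset.sum_nonneg fun i _ => abs_nonneg _) (Ne.symm h0)
  have hw : l1 ((l1 v)⁻¹ • v) = 1 := by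
    have : l1 ((l1 v)⁻¹ • v) = (l1 v)⁻¹ * l1 v := by
      simp only [l1, Pi.smul_apply, smul_eq_mul, abs_mul, ← Finset.mul_sum]
      congr 1
      exact abs_of_pos (inv_pos.2 hpos)
    rw [this, inv_mul_cancel₀ h0]
  -- For the normalized vector `w` this reads `0 ≤ m² q(w) + m (C - q(w))`; dividing by `m` and
  -- undoing the scaling gives the factor `m - 1`.
  have key := le_quadForm_add_smul_of_forall_signedSum hA hC hw m 0
    (fun f => by simpa using h f)
  simp only [zero_add, mulVec_smul, smul_dotProduct, dotProduct_smul, smul_eq_mul] at key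
  set q := v ⬝ᵥ A *ᵥ v
  have h2 : m * ((m - 1) * q + C * l1 v ^ 2) =
      l1 v ^ 2 * (m * ((l1 v)⁻¹ * (m * ((l1 v)⁻¹ * q))) +
        m * (C - (l1 v)⁻¹ * ((l1 v)⁻¹ * q))) := by
    field_simp
    ring
  have h3 : 0 ≤ m * (((m : ℝ) - 1) * q + C * l1 v ^ 2) := by
    rw [h2]; exact mul_nonneg (sq_nonneg _) key
  exact nonneg_of_mul_nonneg_right h3 hm'

/-- The previous result applied to `A - c • 1`, whose diagonal is still at most `C` because `0 ≤ c`.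
-/
theorem l1_sq_lower_bound_of_forall_signedSum {A : Matrix ι ι ℝ} (hA : Aᵀ = A) {C c : ℝ}
    (hc : 0 ≤ c) (hC : ∀ j, A j j ≤ C) {m : ℕ} (hm : 0 < m)
    (h : ∀ f : Fin m → ι × Bool,
      c * (signedSum f ⬝ᵥ signedSum f) ≤ signedSum f ⬝ᵥ A *ᵥ signedSum f) (v : ι → ℝ) :
    0 ≤ ((m : ℝ) - 1) * (v ⬝ᵥ A *ᵥ v - c * (v ⬝ᵥ v)) + C * l1 v ^ 2 := by
  have e : ∀ w : ι → ℝ, w ⬝ᵥ (A - c • (1 : Matrix ι ι ℝ)) *ᵥ w =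
      w ⬝ᵥ A *ᵥ w - c * (w ⬝ᵥ w) := by
    intro w
    simp [sub_mulVec, smul_mulVec]
  have := neg_l1_sq_le_quadForm_of_forall_signedSum (A := A - c • (1 : Matrix ι ι ℝ)) (C := C)
    (by simp [hA]) (fun j => by simpa using (hC j).trans (by linarith)) hm
    (fun f => by rw [e]; linarith [h f]) v
  rwa [e] at this

end Transfer

/-! ### The basic inequality for the doubly penalized least squares estimator -/

section Lasso

variable {ι : Type*} [Fintype ι]

theorem l1_nonneg (v : ι → ℝ) : 0 ≤ l1 v := Finset.sum_nonneg fun _ _ => abs_nonneg _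

theorem sum_support_abs_le (b w : ι → ℝ) [DecidablePred fun i => b i ≠ 0] :
    ∑ i with b i ≠ 0, |w i| ≤ √(l0 b) * √(∑ i, w i ^ 2) := by
  have hcard : ((Finset.univ.filter fun i => b i ≠ 0).card : ℝ) = l0 b := by
    rw [l0, Set.ncard_eq_toFinset_card']
    congr 2
    ext; simp
  rw [← hcard, ← Real.sqrt_mul (by positivity)]
  refine Real.le_sqrt_of_sq_le (sq_sum_le_card_mul_sum_sq.trans ?_)
  simp_rw [sq_abs]
  gcongr
  exact Finset.subset_univ _

theorem l1_sub_l1_add_le (b w : ι → ℝ) [DecidablePred fun i => b i ≠ 0] :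
    l1 b - l1 (b + w) ≤ 2 * (∑ i with b i ≠ 0, |w i|) - l1 w := by
  have key : ∀ i, |b i| - |(b + w) i| ≤ 2 * (if b i ≠ 0 then |w i| else 0) - |w i| := by
    intro i
    simp only [Pi.add_apply]
    split_ifs with h
    · have := abs_sub_abs_le_abs_sub (b i) (b i + w i)
      rw [show b i - (b i + w i) = -w i by ring, abs_neg] at this
      linarith
    · have : b i = 0 := not_not.1 h
      simp [this]
  have := Finset.sum_le_sum fun i (_ : i ∈ Finset.univ) => key i
  rw [Finset.sum_sub_distrib, Finset.sum_sub_distrib, ← Finset.mul_sum, ← Finset.sum_filter] at this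
  exact this

/-- The version for the graph penalty, which needs no negative `ℓ₁`-term; the constant is `1`
because the sum over the support is at most `l1 w`. -/
theorem l1_sub_l1_add_le_sqrt (b w : ι → ℝ) :
    l1 b - l1 (b + w) ≤ √(l0 b) * √(∑ i, w i ^ 2) := by
  classical
  have h1 := l1_sub_l1_add_le b w
  have h2 := sum_support_abs_le b w
  have h3 : ∑ i with b i ≠ 0, |w i| ≤ l1 w :=
    Finset.sum_le_sum_of_subset_of_nonneg (Finset.subset_univ _) fun _ _ _ => abs_nonneg _
  linarith

theorem l1_sub_l1_add_le_two_sqrt (b w : ι → ℝ) :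
    l1 b - l1 (b + w) ≤ 2 * (√(l0 b) * √(∑ i, w i ^ 2)) - l1 w := by
  classical
  have h1 := l1_sub_l1_add_le b w
  have h2 := sum_support_abs_le b w
  linarith

theorem abs_dotProduct_le_of_abs_le {a v : ι → ℝ} {B : ℝ} (h : ∀ i, |a i| ≤ B) :
    |v ⬝ᵥ a| ≤ B * l1 v := by
  rw [dotProduct, l1, Finset.mul_sum]
  refine (Finset.abs_sum_le_sum_abs _ _).trans (Finset.sum_le_sum fun i _ => ?_)
  rw [abs_mul, mul_comm]
  exact mul_le_mul_of_nonneg_right (h i) (abs_nonneg _)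

variable {N n : ℕ}

theorem sampleGram_transpose (X : Matrix (Fin N) (Fin n) ℝ) :
    (sampleGram X)ᵀ = sampleGram X := by
  simp [sampleGram, transpose_mul]

theorem quadForm_sampleGram (X : Matrix (Fin N) (Fin n) ℝ) (v : Fin n → ℝ) :
    v ⬝ᵥ sampleGram X *ᵥ v = 1 / N * ∑ i, (X *ᵥ v) i ^ 2 := by
  rw [sampleGram, smul_mulVec, dotProduct_smul, smul_eq_mul, ← mulVec_mulVec, dotProduct_mulVec,
    vecMul_transpose]
  simp [dotProduct, sq]

/-- The basic inequality of a minimizer of the doubly penalized least squares objective. -/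
theorem lasso_basic_inequality (hN : 0 < N) {m : Type*} [Fintype m] {D : Matrix m (Fin n) ℝ}
    {lamG lam ν B : ℝ} (hlam : 0 ≤ lam) (hν : 0 ≤ ν) (hB : 0 < B)
    (hlamG : lamG = lam * √(ν / B))
    (hD : ∀ v : Fin n → ℝ, ∑ i, (D *ᵥ v) i ^ 2 ≤ B * ∑ j, v j ^ 2)
    {X : Matrix (Fin N) (Fin n) ℝ} {βstar β : Fin n → ℝ} {ε : Fin N → ℝ} {s₁ s₂ : ℕ}
    (hs₁ : l0 (D *ᵥ βstar) ≤ s₁) (hs₂ : l0 βstar ≤ s₂) (hs : ν * s₁ ≤ s₂)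
    (hmin : objective D lamG lam X (response X βstar ε) β ≤
      objective D lamG lam X (response X βstar ε) βstar)
    (hnoise : ∀ j, |(Xᵀ *ᵥ ε) j| ≤ N * (lam / 2)) :
    (β - βstar) ⬝ᵥ sampleGram X *ᵥ (β - βstar) + lam * l1 (β - βstar) ≤
      6 * (lam * (√s₂ * √(∑ i, (β - βstar) i ^ 2))) := by
  obtain ⟨v, rfl⟩ : ∃ v, β = βstar + v := ⟨β - βstar, by abel⟩
  rw [add_sub_cancel_left, quadForm_sampleGram]
  have hN' : (0 : ℝ) < N := by exact_mod_cast hN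
  set r := √(∑ i, v i ^ 2) with hr
  have h1 : ∑ i, (response X βstar ε i - (X *ᵥ (βstar + v)) i) ^ 2 =
      ∑ i, ε i ^ 2 - 2 * (v ⬝ᵥ Xᵀ *ᵥ ε) + ∑ i, (X *ᵥ v) i ^ 2 := by
    have : v ⬝ᵥ Xᵀ *ᵥ ε = ∑ i, (X *ᵥ v) i * ε i := by
      rw [dotProduct_mulVec, vecMul_transpose]; rfl
    rw [this, Finset.mul_sum, ← Finset.sum_sub_distrib, ← Finset.sum_add_distrib]
    refine Finset.sum_congr rfl fun i _ => ?_
    simp only [response, mulVec_add, Pi.add_apply]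
    ring
  have h2 : ∑ i, (response X βstar ε i - (X *ᵥ βstar) i) ^ 2 = ∑ i, ε i ^ 2 := by
    simp [response]
  have h3 : v ⬝ᵥ Xᵀ *ᵥ ε ≤ N * (lam / 2) * l1 v :=
    (le_abs_self _).trans (abs_dotProduct_le_of_abs_le hnoise)
  have h4 : l1 βstar - l1 (βstar + v) ≤ 2 * (√s₂ * r) - l1 v := by
    refine (l1_sub_l1_add_le_two_sqrt _ _).trans ?_
    gcongr
  have h5 : lamG * (l1 (D *ᵥ βstar) - l1 (D *ᵥ (βstar + v))) ≤ lam * (√s₂ * r) := by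
    have h6 : l1 (D *ᵥ βstar) - l1 (D *ᵥ (βstar + v)) ≤ √s₁ * (√B * r) := by
      rw [mulVec_add]
      refine (l1_sub_l1_add_le_sqrt _ _).trans ?_
      rw [hr, ← Real.sqrt_mul hB.le]
      gcongr
      exact hD v
    -- The calibration of `lamG`: the norm bound `√B` of `D` cancels, leaving `√(ν s₁)`.
    have h7 : √(ν / B) * (√s₁ * √B) ≤ √s₂ := by
      rw [← Real.sqrt_mul (by positivity), ← Real.sqrt_mul (by positivity)]
      refine Real.sqrt_le_sqrt (le_trans (le_of_eq ?_) hs)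
      field_simp
    calc lamG * (l1 (D *ᵥ βstar) - l1 (D *ᵥ (βstar + v)))
        ≤ lamG * (√s₁ * (√B * r)) := by
          refine mul_le_mul_of_nonneg_left h6 ?_
          rw [hlamG]; positivity
      _ = lam * (√(ν / B) * (√s₁ * √B) * r) := by rw [hlamG]; ring
      _ ≤ lam * (√s₂ * r) := by gcongr
  simp only [objective] at hmin
  rw [h1, h2] at hmin
  have h8 : 1 / (2 * (N : ℝ)) * (v ⬝ᵥ Xᵀ *ᵥ ε) ≤ lam / 4 * l1 v := by
    rw [div_mul_eq_mul_div, one_mul, div_le_iff₀ (by positivity)]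
    linarith
  have h9 : 1 / (2 * (N : ℝ)) * ∑ i, (X *ᵥ v) i ^ 2 = (1 / N * ∑ i, (X *ᵥ v) i ^ 2) / 2 := by
    field_simp
  have h10 := mul_le_mul_of_nonneg_left h4 hlam
  have h11 : 1 / (2 * (N : ℝ)) * (∑ i, ε i ^ 2 - 2 * (v ⬝ᵥ Xᵀ *ᵥ ε) + ∑ i, (X *ᵥ v) i ^ 2) =
    1 / (2 * (N : ℝ)) * ∑ i, ε i ^ 2 - 2 * (1 / (2 * (N : ℝ)) * (v ⬝ᵥ Xᵀ *ᵥ ε)) +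
    1 / (2 * (N : ℝ)) * ∑ i, (X *ᵥ v) i ^ 2 := by ring
  rw [h11, h9] at hmin
  linarith

/-- The `ℓ₁`-error bound following from the basic inequality and a restricted eigenvalue bound. -/
theorem l1_le_of_basic_inequality {lam c C q : ℝ} {R s : ℕ} (hlam : 0 < lam) (hc : 0 < c)
    (hs : 0 < s) (hR : 72 * C ≤ c * R) {v : Fin n → ℝ} (hq : 0 ≤ q)
    (hbasic : q + lam * l1 v ≤ 6 * (lam * (√s * √(∑ i, v i ^ 2))))
    (hre : 0 ≤ (R * s : ℝ) * (q - c * (v ⬝ᵥ v)) + C * l1 v ^ 2) (hR0 : 0 < R) (hC : 0 ≤ C) :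
    l1 v ≤ 72 * lam * s / c := by
  have hvv : v ⬝ᵥ v = √(∑ i, v i ^ 2) ^ 2 := by
    rw [Real.sq_sqrt (Finset.sum_nonneg fun _ _ => sq_nonneg _)]
    simp [dotProduct, sq]
  rw [hvv] at hre
  set r := √(∑ i, v i ^ 2)
  have hr0 : 0 ≤ r := Real.sqrt_nonneg _
  have hs' : (0 : ℝ) < s := by exact_mod_cast hs
  have hR' : (0 : ℝ) < R := by exact_mod_cast hR0
  have hl := l1_nonneg v
  have hss : √(s : ℝ) * √(s : ℝ) = s := Real.mul_self_sqrt hs'.le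
  have h1 : l1 v ≤ 6 * (√s * r) := by
    have : lam * l1 v ≤ lam * (6 * (√s * r)) := by linarith
    exact le_of_mul_le_mul_left this hlam
  have h2 : l1 v ^ 2 ≤ 36 * s * r ^ 2 := by
    calc l1 v ^ 2 ≤ (6 * (√s * r)) ^ 2 := by gcongr
      _ = 36 * (√s * √s) * r ^ 2 := by ring
      _ = _ := by rw [hss]
  -- On the cone, `72 * C ≤ c * R` makes the `ℓ₁`-correction at most half of the curvature term.
  have h3 : c / 2 * r ^ 2 ≤ q := by
    have : R * s * (c / 2 * r ^ 2) ≤ R * s * q := by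
      have a1 : C * l1 v ^ 2 ≤ C * (36 * s * r ^ 2) := by gcongr
      have a2 : 72 * C * (s * r ^ 2) ≤ c * R * (s * r ^ 2) := by gcongr
      nlinarith
    exact le_of_mul_le_mul_left this (by positivity)
  have h4 : c * r ≤ 12 * lam * √s := by
    rcases hr0.eq_or_lt with h0 | h0
    · rw [← h0]; simp; positivity
    · have : r * (c * r) ≤ r * (12 * lam * √s) := by
        have : 0 ≤ lam * l1 v := by positivity
        nlinarith
      exact le_of_mul_le_mul_left this h0
  rw [le_div_iff₀ hc]
  calc l1 v * c ≤ 6 * (√s * r) * c := by gcongr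
    _ = 6 * √s * (c * r) := by ring
    _ ≤ 6 * √s * (12 * lam * √s) := by gcongr
    _ = 72 * lam * (√s * √s) := by ring
    _ = _ := by rw [hss]

end Lasso

/-! ### The CLIME program -/

section Clime

variable {l m : Type*}

theorem vecMax_nonneg (v : l → ℝ) : 0 ≤ vecMax v := Real.iSup_nonneg fun _ => abs_nonneg _

theorem vecMax_le {v : l → ℝ} {B : ℝ} (hB : 0 ≤ B) (h : ∀ i, |v i| ≤ B) : vecMax v ≤ B :=
  Real.iSup_le h hB

theorem matMax_nonneg (A : Matrix l m ℝ) : 0 ≤ matMax A :=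
  Real.iSup_nonneg fun _ => Real.iSup_nonneg fun _ => abs_nonneg _

theorem matMax_le {A : Matrix l m ℝ} {B : ℝ} (hB : 0 ≤ B) (h : ∀ i j, |A i j| ≤ B) :
    matMax A ≤ B :=
  Real.iSup_le (fun i => Real.iSup_le (h i) hB) hB

theorem abs_le_matMax [Finite l] [Finite m] (A : Matrix l m ℝ) (i : l) (j : m) : |A i j| ≤ matMax A :=
  (le_ciSup (f := fun j => |A i j|) (Set.finite_range _).bddAbove j).trans
    (le_ciSup (f := fun i => ⨆ j, |A i j|) (Set.finite_range _).bddAbove i)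

variable [Fintype m]

theorem row_sum_le_opInf [Finite l] (A : Matrix l m ℝ) (i : l) : ∑ j, |A i j| ≤ opInf A :=
  le_ciSup (f := fun i => ∑ j, |A i j|) (Set.finite_range _).bddAbove i

theorem abs_mul_transpose_le {k : Type*} {E : Matrix l m ℝ} {R : Matrix k m ℝ} {μ M : ℝ}
    (hμ : 0 ≤ μ) (hE : ∀ i j, |E i j| ≤ μ) (hR : ∀ i, ∑ j, |R i j| ≤ M) (i : l) (j : k) :
    |(E * Rᵀ) i j| ≤ μ * M := by
  have h := abs_dotProduct_le_of_abs_le (v := R j) fun a => hE i a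
  rw [dotProduct_comm] at h
  refine h.trans ?_
  exact mul_le_mul_of_nonneg_left (hR j) hμ

theorem abs_mul_mul_transpose_le {k : Type*} {D : Matrix k m ℝ} {K : Matrix m m ℝ} {μ r : ℝ}
    (hμ : 0 ≤ μ) (hr : 0 ≤ r) (hK : ∀ i j, |K i j| ≤ μ) (hD : ∀ i, ∑ j, |D i j| ≤ r) (i j : k) :
    |(D * K * Dᵀ) i j| ≤ r ^ 2 * μ := by
  have h1 : ∀ a b, |(D * K) a b| ≤ μ * r := by
    intro a b
    have := abs_mul_transpose_le (E := Kᵀ) (R := D) hμ (fun i j => hK j i) hD b a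
    rwa [← transpose_mul, transpose_apply] at this
  exact (abs_mul_transpose_le (by positivity) h1 hD i j).trans_eq (by ring)

variable {n : ℕ}

/-- Objective and constraint both decouple over rows: replacing row `i` of the minimizer by that of
`Θ₀` keeps feasibility, so it cannot lower the objective. -/
theorem IsClime.row_sum_le {Sg Θ Θ₀ : Matrix (Fin n) (Fin n) ℝ} {μ : ℝ} (h : IsClime Sg μ Θ)
    (h₀ : ClimeFeasible Sg μ Θ₀) (i : Fin n) : ∑ j, |Θ i j| ≤ ∑ j, |Θ₀ i j| := by
  have hμ : 0 ≤ μ := (matMax_nonneg _).trans h₀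
  have hf : ClimeFeasible Sg μ (Θ.updateRow i (Θ₀ i)) := by
    refine matMax_le hμ fun a b => ?_
    by_cases ha : a = i
    · subst ha
      have := (abs_le_matMax _ a b).trans h₀
      simpa [Matrix.sub_apply, mul_apply, updateRow_self] using this
    · have := (abs_le_matMax _ a b).trans h.1
      simpa [Matrix.sub_apply, mul_apply, updateRow_ne ha] using this
  have h2 := h.2 _ hf
  simp only [l11] at h2
  rw [← Finset.add_sum_erase _ _ (Finset.mem_univ i),
    ← Finset.add_sum_erase _ (fun a => ∑ j, |Θ.updateRow i (Θ₀ i) a j|) (Finset.mem_univ i)] at h2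
  have h3 : ∑ a ∈ Finset.univ.erase i, ∑ j, |Θ.updateRow i (Θ₀ i) a j| =
      ∑ a ∈ Finset.univ.erase i, ∑ j, |Θ a j| := by
    refine Finset.sum_congr rfl fun a ha => ?_
    rw [updateRow_ne (Finset.ne_of_mem_erase ha)]
  rw [h3, updateRow_self] at h2
  linarith

theorem IsClime.abs_sandwich_sub_le {Sg Θ T : Matrix (Fin n) (Fin n) ℝ} {μ M : ℝ}
    (h : IsClime Sg μ Θ) (hSg : Sgᵀ = Sg) (hT : Tᵀ = T) (hfeas : ClimeFeasible Sg μ T)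
    (hM : opInf T ≤ M) (i j : Fin n) : |(Θ * Sg * Θᵀ - T) i j| ≤ 3 * (μ * M) := by
  have hμ : 0 ≤ μ := (matMax_nonneg _).trans hfeas
  have hTrow : ∀ i, ∑ j, |T i j| ≤ M := fun i => (row_sum_le_opInf T i).trans hM
  have hΘrow : ∀ i, ∑ j, |Θ i j| ≤ M := fun i => (h.row_sum_le hfeas i).trans (hTrow i)
  have hE : ∀ i j, |(Θ * Sg - 1) i j| ≤ μ := fun i j => (abs_le_matMax _ i j).trans h.1
  have hF : ∀ i j, |(T * Sg - 1) i j| ≤ μ := fun i j => (abs_le_matMax _ i j).trans hfeas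
  have e : Θ * Sg * Θᵀ - T =
      (Θ * Sg - 1) * Θᵀ - (T * Sg - 1) * Θᵀ + ((Θ * Sg - 1) * Tᵀ)ᵀ := by
    simp only [transpose_mul, transpose_sub, hSg, hT, sub_mul, one_mul, Matrix.mul_assoc]
    abel
  rw [e]
  have h1 := abs_mul_transpose_le hμ hE hΘrow i j
  have h2 := abs_mul_transpose_le hμ hF hΘrow i j
  have h3 := abs_mul_transpose_le hμ hE hTrow j i
  simp only [Matrix.add_apply, Matrix.sub_apply, transpose_apply]
  refine (abs_add_le _ _).trans ?_
  refine (add_le_add_left (abs_sub _ _) _).trans ?_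
  linarith

theorem climeFeasible_zero {Sg : Matrix (Fin n) (Fin n) ℝ} {μ : ℝ} (hμ : 1 ≤ μ) :
    ClimeFeasible Sg μ 0 := by
  refine matMax_le (by linarith) fun i j => ?_
  rw [Matrix.zero_mul, zero_sub, neg_apply, abs_neg, one_apply]
  split_ifs <;> simp <;> linarith

theorem IsClime.eq_zero {Sg Θ : Matrix (Fin n) (Fin n) ℝ} {μ : ℝ} (h : IsClime Sg μ Θ)
    (hμ : 1 ≤ μ) : Θ = 0 := by
  have h2 := h.2 0 (climeFeasible_zero hμ)
  ext i j
  have : l11 Θ = 0 := le_antisymm (by simpa [l11] using h2)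
    (Finset.sum_nonneg fun _ _ => Finset.sum_nonneg fun _ _ => abs_nonneg _)
  have := (Finset.sum_eq_zero_iff_of_nonneg
    (fun i _ => Finset.sum_nonneg fun _ _ => abs_nonneg _)).1 this i (Finset.mem_univ i)
  have := (Finset.sum_eq_zero_iff_of_nonneg (fun j _ => abs_nonneg _)).1 this j (Finset.mem_univ j)
  simpa using this

end Clime

/-! ### The one-step estimator -/

section OneStep

variable {N n : ℕ} {m : Type*}

theorem oneStep_decomposition (hN : 0 < N) (D : Matrix m (Fin n) ℝ)
    (Θ : Matrix (Fin n) (Fin n) ℝ) (X : Matrix (Fin N) (Fin n) ℝ) (βstar β : Fin n → ℝ)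
    (ε : Fin N → ℝ) :
    √(N : ℝ) • (D *ᵥ oneStep Θ X (response X βstar ε) β - D *ᵥ βstar) =
      noiseTerm D Θ X ε - remainder D Θ X β βstar := by
  have hN' : (0 : ℝ) < √(N : ℝ) := Real.sqrt_pos.2 (by exact_mod_cast hN)
  have h1 : (1 / √(N : ℝ)) = √(N : ℝ) * (1 / N) := by
    have : (N : ℝ) = √N * √N := (Real.mul_self_sqrt (by positivity)).symm
    rw [mul_one_div]
    nth_rewrite 3 [this]
    field_simp
  rw [noiseTerm, remainder, h1, mul_smul, ← smul_sub]
  congr 1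
  simp only [oneStep, response, sampleGram, mulVec_add, mulVec_sub, mulVec_smul, mulVec_mulVec,
    Matrix.mul_sub, sub_mulVec, Matrix.mul_smul, smul_mulVec, Matrix.mul_assoc, Matrix.mul_one,
    smul_add, smul_sub]
  abel

theorem vecMax_remainder_le [Fintype m] {D : Matrix m (Fin n) ℝ} {Θ : Matrix (Fin n) (Fin n) ℝ}
    {X : Matrix (Fin N) (Fin n) ℝ} {β βstar : Fin n → ℝ} {r μ : ℝ} (hr : 0 ≤ r) (hμ : 0 ≤ μ)
    (hD : ∀ i, ∑ j, |D i j| ≤ r) (hΘ : ClimeFeasible (sampleGram X) μ Θ) :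
    vecMax (remainder D Θ X β βstar) ≤ √(N : ℝ) * (r * μ * l1 (β - βstar)) := by
  have hl := l1_nonneg (β - βstar)
  refine vecMax_le (by positivity) fun i => ?_
  rw [remainder, Pi.smul_apply, smul_eq_mul, abs_mul, abs_of_nonneg (Real.sqrt_nonneg _)]
  refine mul_le_mul_of_nonneg_left ?_ (Real.sqrt_nonneg _)
  have h1 : ∀ a b, |(D * (Θ * sampleGram X - 1) : Matrix m (Fin n) ℝ) a b| ≤ μ * r := by
    intro a b
    have := abs_mul_transpose_le (E := (Θ * sampleGram X - (1 : Matrix (Fin n) (Fin n) ℝ))ᵀ) (R := D) hμ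
      (fun i j => (abs_le_matMax _ j i).trans hΘ) hD b a
    rwa [← transpose_mul, transpose_apply] at this
  rw [mulVec, dotProduct_comm, mul_comm r μ]
  exact abs_dotProduct_le_of_abs_le fun b => h1 i b

end OneStep

/-! ### Exponential moments of squares of sub-Gaussian variables -/

section ExpSquare

theorem exp_mul_sub_one_sub_le {r w : ℝ} (hr : |r| ≤ 1) (hw : 0 ≤ w) :
    Real.exp (r * w) - 1 - r * w ≤ r ^ 2 * (Real.exp w - 1 - w) := by
  have hsum : ∀ x : ℝ, HasSum (fun k : ℕ => x ^ (k + 2) / (k + 2).factorial)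
      (Real.exp x - 1 - x) := by
    intro x
    have h := NormedSpace.expSeries_div_hasSum_exp (𝔸 := ℝ) x
    rw [← Real.exp_eq_exp_ℝ] at h
    have h2 := (hasSum_nat_add_iff' 2).2 h
    simpa [Finset.sum_range_succ, sub_sub] using h2
  refine hasSum_le (fun k => ?_) (hsum (r * w)) ((hsum w).mul_left (r ^ 2))
  rw [mul_pow, mul_div_assoc, pow_add r k 2, mul_comm (r ^ k) (r ^ 2), mul_assoc]
  refine mul_le_mul_of_nonneg_left ?_ (sq_nonneg r)
  have h1 : r ^ k ≤ 1 := (le_abs_self _).trans (by rw [abs_pow]; exact pow_le_one₀ (abs_nonneg _) hr)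
  exact mul_le_of_le_one_left (by positivity) h1

theorem lintegral_exp_sq_div_four_gaussianReal :
    ∫⁻ g, ENNReal.ofReal (Real.exp (g ^ 2 / 4)) ∂gaussianReal 0 1 ≤ ENNReal.ofReal (3 / 2) := by
  have hpdf : ∀ g : ℝ, gaussianPDF 0 1 g * ENNReal.ofReal (Real.exp (g ^ 2 / 4)) =
      ENNReal.ofReal ((√(2 * Real.pi))⁻¹ * Real.exp (-(1 / 4) * g ^ 2)) := by
    intro g
    rw [gaussianPDF, ← ENNReal.ofReal_mul (gaussianPDFReal_nonneg _ _ _), gaussianPDFReal,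
      mul_assoc, ← Real.exp_add]
    congr 2
    · simp
    · congr 1
      simp only [sub_zero, NNReal.coe_one, mul_one]
      ring
  rw [gaussianReal_of_var_ne_zero _ one_ne_zero,
    lintegral_withDensity_eq_lintegral_mul _ (measurable_gaussianPDF _ _) (by fun_prop)]
  simp only [Pi.mul_apply, hpdf]
  rw [← ofReal_integral_eq_lintegral_ofReal
    ((integrable_exp_neg_mul_sq (by norm_num)).const_mul _)
    (Eventually.of_forall fun g => by positivity), integral_const_mul, integral_gaussian]
  refine ENNReal.ofReal_le_ofReal ?_
  rw [inv_mul_le_iff₀ (Real.sqrt_pos.2 (by positivity)), Real.sqrt_le_left (by positivity),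
    mul_pow, Real.sq_sqrt (by positivity)]
  nlinarith [Real.pi_pos]

variable {Ω : Type*} [MeasurableSpace Ω] {P : Measure Ω}

theorem integrable_exp_mul_of_abs_le {Y : Ω → ℝ} (hYm : Measurable Y) (hY0 : ∀ ω, 0 ≤ Y ω)
    {c : ℝ} (hY : Integrable (fun ω => Real.exp (c * Y ω)) P) {s : ℝ} (hs : s ≤ c) :
    Integrable (fun ω => Real.exp (s * Y ω)) P := by
  refine hY.mono' (by fun_prop) (Eventually.of_forall fun ω => ?_)
  rw [Real.norm_eq_abs, Real.abs_exp]
  exact Real.exp_le_exp.2 (mul_le_mul_of_nonneg_right hs (hY0 ω))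

theorem integrable_of_integrable_exp {Y : Ω → ℝ} (hYm : Measurable Y) (hY0 : ∀ ω, 0 ≤ Y ω)
    {c : ℝ} (hc : 0 < c) (hY : Integrable (fun ω => Real.exp (c * Y ω)) P) : Integrable Y P := by
  refine (hY.const_mul c⁻¹).mono' (by fun_prop) (Eventually.of_forall fun ω => ?_)
  rw [Real.norm_eq_abs, abs_of_nonneg (hY0 ω), ← div_eq_inv_mul, le_div_iff₀ hc]
  linarith [Real.add_one_le_exp (c * Y ω)]

variable [IsProbabilityMeasure P]

/-- Gaussian linearization: `exp (z² / (4σ²))` is the moment generating function of a standard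
normal `g` at `b z`. After exchanging the integrals the sub-Gaussian bound leaves `E exp (g² / 4) =
√2 ≤ 3 / 2`. Lower integrals avoid presupposing integrability. -/
theorem lintegral_exp_sq_le {Z : Ω → ℝ} (hZm : Measurable Z) {σ : ℝ} (hσ : 0 < σ)
    (hZ : HasSubgaussianMGF Z (σ ^ 2).toNNReal P) :
    ∫⁻ ω, ENNReal.ofReal (Real.exp (1 / (4 * σ ^ 2) * Z ω ^ 2)) ∂P ≤ ENNReal.ofReal (3 / 2) := by
  set b : ℝ := 1 / (√2 * σ) with hb
  have hbσ : σ ^ 2 * b ^ 2 = 1 / 2 := by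
    rw [hb, div_pow, mul_pow, Real.sq_sqrt (by norm_num)]
    field_simp
  have h1 : ∀ z : ℝ, ENNReal.ofReal (Real.exp (1 / (4 * σ ^ 2) * z ^ 2)) =
      ∫⁻ g, ENNReal.ofReal (Real.exp (b * z * g)) ∂gaussianReal 0 1 := by
    intro z
    rw [← ofReal_integral_eq_lintegral_ofReal (integrable_exp_mul_gaussianReal _)
      (Eventually.of_forall fun g => by positivity)]
    have := congrFun (mgf_id_gaussianReal (μ := 0) (v := 1)) (b * z)
    simp only [mgf, id] at this
    rw [this]
    congr 2
    have : b ^ 2 = 1 / 2 / σ ^ 2 := by rw [← hbσ]; field_simp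
    simp only [zero_mul, NNReal.coe_one, one_mul, zero_add, mul_pow, this]
    field_simp
    norm_num
    ring
  simp_rw [h1]
  rw [lintegral_lintegral_swap (by fun_prop)]
  refine le_trans (lintegral_mono fun g => ?_) lintegral_exp_sq_div_four_gaussianReal
  have h2 : ∀ ω, b * Z ω * g = b * g * Z ω := fun ω => by ring
  simp_rw [h2]
  rw [← ofReal_integral_eq_lintegral_ofReal (hZ.integrable_exp_mul _)
    (Eventually.of_forall fun g => by positivity)]
  refine ENNReal.ofReal_le_ofReal ((hZ.mgf_le (b * g)).trans (Real.exp_le_exp.2 ?_))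
  rw [Real.coe_toNNReal _ (sq_nonneg σ), mul_pow, ← mul_assoc, hbσ]
  exact le_of_eq (by ring)

theorem integrable_exp_sq {Z : Ω → ℝ} (hZm : Measurable Z) {σ : ℝ} (hσ : 0 < σ)
    (hZ : HasSubgaussianMGF Z (σ ^ 2).toNNReal P) :
    Integrable (fun ω => Real.exp (1 / (4 * σ ^ 2) * Z ω ^ 2)) P := by
  refine ⟨by fun_prop, ?_⟩
  rw [hasFiniteIntegral_iff_ofReal (Eventually.of_forall fun g => by positivity)]
  exact (lintegral_exp_sq_le hZm hσ hZ).trans_lt ENNReal.ofReal_lt_top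

theorem integral_exp_sq_le {Z : Ω → ℝ} (hZm : Measurable Z) {σ : ℝ} (hσ : 0 < σ)
    (hZ : HasSubgaussianMGF Z (σ ^ 2).toNNReal P) :
    ∫ ω, Real.exp (1 / (4 * σ ^ 2) * Z ω ^ 2) ∂P ≤ 3 / 2 := by
  have := lintegral_exp_sq_le hZm hσ hZ
  rwa [← ofReal_integral_eq_lintegral_ofReal (integrable_exp_sq hZm hσ hZ)
    (Eventually.of_forall fun g => by positivity),
    ENNReal.ofReal_le_ofReal_iff (by norm_num)] at this

/-- As `E Y ≥ 0`, the second-order remainder `E (exp (c Y) - 1 - c Y)` is at most `1 / 2`; passing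
from `c` to `s` scales it by `(s / c) ^ 2`. -/
theorem mgf_centered_le {Y : Ω → ℝ} (hYm : Measurable Y) (hY0 : ∀ ω, 0 ≤ Y ω) {c : ℝ} (hc : 0 < c)
    (hY : Integrable (fun ω => Real.exp (c * Y ω)) P) (hY2 : ∫ ω, Real.exp (c * Y ω) ∂P ≤ 3 / 2)
    {s : ℝ} (hs : |s| ≤ c) :
    mgf (fun ω => Y ω - ∫ ω, Y ω ∂P) P s ≤ Real.exp (s ^ 2 / (2 * c ^ 2)) := by
  have hYi := integrable_of_integrable_exp hYm hY0 hc hY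
  have hEY : 0 ≤ ∫ ω, Y ω ∂P := integral_nonneg hY0
  have hsY := integrable_exp_mul_of_abs_le hYm hY0 hY ((le_abs_self s).trans hs)
  have h1 : ∫ ω, Real.exp (s * Y ω) ∂P ≤ 1 + s * (∫ ω, Y ω ∂P) + s ^ 2 / (2 * c ^ 2) := by
    have hpt : ∀ ω, Real.exp (s * Y ω) ≤
        1 + s * Y ω + (s / c) ^ 2 * (Real.exp (c * Y ω) - 1 - c * Y ω) := by
      intro ω
      have := exp_mul_sub_one_sub_le (r := s / c) (w := c * Y ω)
        (by rw [abs_div, abs_of_pos hc]; exact (div_le_one hc).2 hs) (mul_nonneg hc.le (hY0 ω))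
      rw [show s / c * (c * Y ω) = s * Y ω by field_simp] at this
      linarith
    have i1 : Integrable (fun ω => 1 + s * Y ω) P := (integrable_const _).add (hYi.const_mul s)
    have i2 : Integrable (fun ω => Real.exp (c * Y ω) - 1 - c * Y ω) P :=
      (hY.sub (integrable_const _)).sub (hYi.const_mul c)
    refine (integral_mono hsY (i1.add (i2.const_mul ((s / c) ^ 2))) hpt).trans ?_
    rw [integral_add' i1 (i2.const_mul _), integral_const_mul,
      integral_add (integrable_const _) (hYi.const_mul s),
      integral_sub (f := fun ω => Real.exp (c * Y ω) - 1) (hY.sub (integrable_const _))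
        (hYi.const_mul c),
      integral_sub hY (integrable_const _), integral_const_mul, integral_const_mul]
    simp only [integral_const, probReal_univ, one_smul]
    have : (s / c) ^ 2 * (∫ ω, Real.exp (c * Y ω) ∂P - 1 - c * ∫ ω, Y ω ∂P) ≤
        (s / c) ^ 2 * (1 / 2) := by
      refine mul_le_mul_of_nonneg_left ?_ (sq_nonneg _)
      have : 0 ≤ c * ∫ ω, Y ω ∂P := by positivity
      linarith
    have e : (s / c) ^ 2 * (1 / 2) = s ^ 2 / (2 * c ^ 2) := by field_simp
    linarith
  have h2 : mgf (fun ω => Y ω - ∫ ω, Y ω ∂P) P s =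
      Real.exp (-(s * ∫ ω, Y ω ∂P)) * ∫ ω, Real.exp (s * Y ω) ∂P := by
    rw [mgf, ← integral_const_mul]
    congr 1; ext ω
    rw [← Real.exp_add]; ring_nf
  rw [h2]
  calc _ ≤ Real.exp (-(s * ∫ ω, Y ω ∂P)) *
        Real.exp (s * (∫ ω, Y ω ∂P) + s ^ 2 / (2 * c ^ 2)) := by
        refine mul_le_mul_of_nonneg_left (h1.trans ?_) (Real.exp_pos _).le
        have := Real.add_one_le_exp (s * (∫ ω, Y ω ∂P) + s ^ 2 / (2 * c ^ 2))
        linarith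
    _ = _ := by rw [← Real.exp_add]; congr 1; ring

theorem measureReal_sum_ge_le {N : ℕ} {Z : Fin N → Ω → ℝ} (hZ : iIndepFun Z P)
    (hZm : ∀ i, Measurable (Z i)) {s b t : ℝ} (hs : 0 ≤ s)
    (hint : ∀ i, Integrable (fun ω => Real.exp (s * Z i ω)) P)
    (hmgf : ∀ i, mgf (Z i) P s ≤ Real.exp b) :
    P.real {ω | N * t ≤ ∑ i, Z i ω} ≤ Real.exp (N * (b - s * t)) := by
  have h := measure_ge_le_exp_mul_mgf (X := ∑ i, Z i) (μ := P) (t := s) (N * t) hs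
    (hZ.integrable_exp_mul_sum hZm fun i _ => hint i)
  rw [hZ.mgf_sum hZm] at h
  simp only [Finset.sum_apply] at h
  refine h.trans ?_
  have : ∏ i, mgf (Z i) P s ≤ Real.exp (N * b) := by
    refine (Finset.prod_le_prod (fun i _ => mgf_nonneg) fun i _ => hmgf i).trans ?_
    rw [Finset.prod_const, Finset.card_univ, Fintype.card_fin, ← Real.exp_nat_mul]
  refine (mul_le_mul_of_nonneg_left this (Real.exp_pos _).le).trans_eq ?_
  rw [← Real.exp_add]; congr 1; ring

theorem measureReal_abs_sum_centered_ge_le {N : ℕ} {Y : Fin N → Ω → ℝ} (hY : iIndepFun Y P)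
    (hYm : ∀ i, Measurable (Y i)) (hY0 : ∀ i ω, 0 ≤ Y i ω) {c : ℝ} (hc : 0 < c)
    (hint : ∀ i, Integrable (fun ω => Real.exp (c * Y i ω)) P)
    (hexp : ∀ i, ∫ ω, Real.exp (c * Y i ω) ∂P ≤ 3 / 2) {t : ℝ} (ht : 0 ≤ t) (htc : t ≤ 1 / c) :
    P.real {ω | N * t ≤ |∑ i, (Y i ω - ∫ ω, Y i ω ∂P)|} ≤ 2 * Real.exp (-(N * (c * t) ^ 2 / 2)) := by
  -- The exponent `s² / (2c²) - s t` is minimal at `s = c² t`; `t ≤ 1 / c` keeps this in the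
  -- admissible range.
  have hs : |c ^ 2 * t| ≤ c := by
    rw [abs_of_nonneg (by positivity)]
    rw [le_div_iff₀ hc] at htc
    nlinarith
  have e : ∀ s : ℝ, s ^ 2 = (c ^ 2 * t) ^ 2 → (N : ℝ) * (s ^ 2 / (2 * c ^ 2) - c ^ 2 * t * t) =
      -(N * (c * t) ^ 2 / 2) := by
    intro s h
    rw [h]; field_simp; ring
  have hci : ∀ i s, s ≤ c → Integrable (fun ω => Real.exp (s * (Y i ω - ∫ ω, Y i ω ∂P))) P := by
    intro i s hs
    have := (integrable_exp_mul_of_abs_le (hYm i) (hY0 i) (hint i) hs).mul_const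
      (Real.exp (-(s * ∫ ω, Y i ω ∂P)))
    refine this.congr (Eventually.of_forall fun ω => ?_)
    simp only
    rw [← Real.exp_add]; congr 1; ring
  have h1 := measureReal_sum_ge_le (Z := fun i ω => Y i ω - ∫ ω, Y i ω ∂P) (t := t)
    (hY.comp (fun i y => y - ∫ ω, Y i ω ∂P) fun i => by fun_prop) (fun i => by fun_prop)
    (s := c ^ 2 * t) (by positivity) (fun i => hci i _ ((le_abs_self _).trans hs))
    (fun i => mgf_centered_le (hYm i) (hY0 i) hc (hint i) (hexp i) hs)
  have h2 := measureReal_sum_ge_le (Z := fun i ω => -(Y i ω - ∫ ω, Y i ω ∂P)) (t := t)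
    (hY.comp (fun i y => -(y - ∫ ω, Y i ω ∂P)) fun i => by fun_prop) (fun i => by fun_prop)
    (s := c ^ 2 * t) (b := (-(c ^ 2 * t)) ^ 2 / (2 * c ^ 2)) (by positivity)
    (fun i => by
      have := hci i (-(c ^ 2 * t)) ((neg_le_abs _).trans hs)
      refine this.congr (Eventually.of_forall fun ω => ?_)
      simp only
      congr 1; ring)
    (fun i => by
      have := mgf_centered_le (hYm i) (hY0 i) hc (hint i) (hexp i) (s := -(c ^ 2 * t))
        (by rwa [abs_neg])
      refine le_trans (le_of_eq ?_) this
      simp only [mgf]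
      congr 1; ext ω; congr 1; ring)
  rw [e _ rfl] at h1
  rw [e _ (neg_sq _)] at h2
  have hsub : {ω | N * t ≤ |∑ i, (Y i ω - ∫ ω, Y i ω ∂P)|} ⊆
      {ω | N * t ≤ ∑ i, (Y i ω - ∫ ω, Y i ω ∂P)} ∪
      {ω | N * t ≤ ∑ i, -(Y i ω - ∫ ω, Y i ω ∂P)} := by
    intro ω hω
    rw [Set.mem_ofPred_eq] at hω
    rcases le_abs.1 hω with h | h
    · exact Or.inl h
    · right
      simp only [Set.mem_ofPred_eq, Finset.sum_neg_distrib]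
      exact h
  refine (measureReal_mono hsub).trans ((measureReal_union_le _ _).trans ?_)
  linarith

end ExpSquare

/-! ### Concentration for sub-Gaussian designs -/

theorem measurable_matrix_entry {m n : Type*} (i : m) (j : n) :
    Measurable fun x : Matrix m n ℝ => x i j :=
  (measurable_pi_apply j).comp (measurable_pi_apply (X := fun _ : m => n → ℝ) i)

section Design

variable {Ω : Type*} [MeasurableSpace Ω] {P : Measure Ω} [IsProbabilityMeasure P] {N n : ℕ}
  {X : Ω → Matrix (Fin N) (Fin n) ℝ} {σ : ℝ} {S : Matrix (Fin n) (Fin n) ℝ}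

omit [IsProbabilityMeasure P] in
theorem IsSubGaussianDesign.measurable_entry (hX : IsSubGaussianDesign P X σ S) (i : Fin N)
    (j : Fin n) : Measurable fun ω => X ω i j :=
  (measurable_matrix_entry i j).comp hX.measurable

omit [IsProbabilityMeasure P] in
theorem IsSubGaussianDesign.measurable_dotProduct (hX : IsSubGaussianDesign P X σ S) (i : Fin N)
    (u : Fin n → ℝ) : Measurable fun ω => u ⬝ᵥ X ω i :=
  Finset.measurable_sum _ fun j _ => (hX.measurable_entry i j).const_mul _

omit [IsProbabilityMeasure P] in
theorem IsSubGaussianDesign.memLp_entry (hX : IsSubGaussianDesign P X σ S) (i : Fin N)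
    (j : Fin n) : MemLp (fun ω => X ω i j) 2 P := by
  have := (hX.subGaussian i (Pi.single j 1) (by simp)).2.memLp 2
  simpa using this

theorem IsSubGaussianDesign.integral_sq (hX : IsSubGaussianDesign P X σ S) (i : Fin N)
    (u : Fin n → ℝ) : ∫ ω, (u ⬝ᵥ X ω i) ^ 2 ∂P = u ⬝ᵥ S *ᵥ u := by
  have hm : ∀ j, MemLp (fun ω => u j * X ω i j) 2 P := fun j => (hX.memLp_entry i j).const_mul _
  have h0 : ∫ ω, u ⬝ᵥ X ω i ∂P = 0 := by
    simp only [dotProduct]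
    rw [integral_finsetSum _ fun j _ => (hm j).integrable (by norm_num)]
    simp [integral_const_mul, hX.mean]
  have h1 := covariance_fun_sum_fun_sum (μ := P) hm hm
  simp_rw [covariance_const_mul_left, covariance_const_mul_right, hX.cov] at h1
  have h2 : cov[fun ω => u ⬝ᵥ X ω i, fun ω => u ⬝ᵥ X ω i; P] = u ⬝ᵥ S *ᵥ u := by
    refine h1.trans ?_
    simp only [dotProduct, mulVec, Finset.mul_sum]
    refine Finset.sum_congr rfl fun a _ => Finset.sum_congr rfl fun b _ => by ring
  rw [← h2, covariance, h0]
  congr 1; ext ω; ring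

omit [IsProbabilityMeasure P] in
theorem IsSubGaussianDesign.iIndepFun_sq (hX : IsSubGaussianDesign P X σ S) (u : Fin n → ℝ) :
    iIndepFun (fun (i : Fin N) ω => (u ⬝ᵥ X ω i) ^ 2) P :=
  hX.indep.comp (fun _ row => (u ⬝ᵥ row) ^ 2) fun _ => by
    simp only [dotProduct]; fun_prop

theorem IsSubGaussianDesign.measureReal_quadForm_unit (hX : IsSubGaussianDesign P X σ S)
    (hσ : 0 < σ) (hN : 0 < N) {u : Fin n → ℝ} (hu : u ⬝ᵥ u = 1) {t : ℝ} (ht : 0 ≤ t)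
    (htσ : t ≤ 4 * σ ^ 2) :
    P.real {ω | t ≤ |u ⬝ᵥ sampleGram (X ω) *ᵥ u - u ⬝ᵥ S *ᵥ u|} ≤
      2 * Real.exp (-(N * t ^ 2 / (32 * σ ^ 4))) := by
  have hN' : (0 : ℝ) < N := by exact_mod_cast hN
  have h := measureReal_abs_sum_centered_ge_le (hX.iIndepFun_sq u)
    (fun i => (hX.measurable_dotProduct i u).pow_const 2) (fun i ω => sq_nonneg _)
    (c := 1 / (4 * σ ^ 2)) (by positivity)
    (fun i => integrable_exp_sq (hX.measurable_dotProduct i u) hσ (hX.subGaussian i u hu).2)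
    (fun i => integral_exp_sq_le (hX.measurable_dotProduct i u) hσ (hX.subGaussian i u hu).2)
    ht (by rwa [one_div_one_div])
  have e1 : -(N * (1 / (4 * σ ^ 2) * t) ^ 2 / 2) = -(N * t ^ 2 / (32 * σ ^ 4)) := by
    field_simp; norm_num; ring
  rw [e1] at h
  refine le_trans (measureReal_mono ?_) h
  intro ω hω
  rw [Set.mem_ofPred_eq] at hω ⊢
  simp_rw [hX.integral_sq]
  have e2 : ∑ i : Fin N, ((u ⬝ᵥ X ω i) ^ 2 - u ⬝ᵥ S *ᵥ u) =
      N * (u ⬝ᵥ sampleGram (X ω) *ᵥ u - u ⬝ᵥ S *ᵥ u) := by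
    rw [quadForm_sampleGram, Finset.sum_sub_distrib]
    simp only [Finset.sum_const, Finset.card_univ, Fintype.card_fin, nsmul_eq_mul, mulVec]
    simp_rw [dotProduct_comm u]
    field_simp
  rw [e2, abs_mul, abs_of_pos hN']
  exact mul_le_mul_of_nonneg_left hω hN'.le

theorem IsSubGaussianDesign.measureReal_quadForm (hX : IsSubGaussianDesign P X σ S)
    (hσ : 0 < σ) (hN : 0 < N) (u : Fin n → ℝ) {t : ℝ} (ht : 0 ≤ t) (htσ : t ≤ 4 * σ ^ 2) :
    P.real {ω | t * (u ⬝ᵥ u) < |u ⬝ᵥ sampleGram (X ω) *ᵥ u - u ⬝ᵥ S *ᵥ u|} ≤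
      2 * Real.exp (-(N * t ^ 2 / (32 * σ ^ 4))) := by
  by_cases hu : u = 0
  · subst hu
    simp only [zero_dotProduct, mul_zero, sub_zero, abs_zero, lt_irrefl]
    rw [Set.ofPred_false, measureReal_empty]
    positivity
  have hpos : 0 < u ⬝ᵥ u := by
    refine lt_of_le_of_ne (Finset.sum_nonneg fun i _ => mul_self_nonneg _) ?_
    exact fun h => hu (dotProduct_self_eq_zero.1 h.symm)
  set r := √(u ⬝ᵥ u) with hr
  have hr0 : 0 < r := Real.sqrt_pos.2 hpos
  have hrr : r * r = u ⬝ᵥ u := Real.mul_self_sqrt hpos.le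
  have hw : (r⁻¹ • u) ⬝ᵥ (r⁻¹ • u) = 1 := by
    rw [smul_dotProduct, dotProduct_smul, smul_eq_mul, smul_eq_mul, ← hrr]
    field_simp
  refine le_trans (measureReal_mono ?_) (hX.measureReal_quadForm_unit hσ hN hw ht htσ)
  intro ω hω
  rw [Set.mem_ofPred_eq] at hω ⊢
  simp only [mulVec_smul, smul_dotProduct, dotProduct_smul, smul_eq_mul]
  rw [← mul_sub, ← mul_sub, ← mul_assoc, abs_mul, ← mul_inv, hrr, abs_of_pos (inv_pos.2 hpos),
    le_inv_mul_iff₀ hpos, mul_comm]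
  exact hω.le

omit [IsProbabilityMeasure P] in
theorem IsSubGaussianDesign.transpose_cov (hX : IsSubGaussianDesign P X σ S) (hN : 0 < N) :
    Sᵀ = S := by
  ext a b
  rw [transpose_apply, ← hX.cov ⟨0, hN⟩, ← hX.cov ⟨0, hN⟩, covariance_comm]

end Design

/-! ### Eigenvalue bounds -/

section Spectrum

variable {n : ℕ} {S : Matrix (Fin n) (Fin n) ℝ} {a b : ℝ}

theorem le_quadForm_of_spectrum (hS : Sᵀ = S) (h : spectrum ℝ S ⊆ Set.Icc a b) (u : Fin n → ℝ) :
    a * (u ⬝ᵥ u) ≤ u ⬝ᵥ S *ᵥ u := by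
  have hH : S.IsHermitian := by rwa [IsHermitian, conjTranspose_eq_transpose_of_trivial]
  have : (S - algebraMap ℝ _ a).PosSemidef := by
    rw [posSemidef_iff_isHermitian_and_spectrum_nonneg]
    refine ⟨hH.sub (by simp [IsHermitian, algebraMap_eq_diagonal]), ?_⟩
    rw [← spectrum.sub_singleton_eq]
    rintro _ ⟨x, hx, _, rfl, rfl⟩
    have := (h hx).1
    simpa using this
  have := this.dotProduct_mulVec_nonneg u
  rw [sub_mulVec, dotProduct_sub, Algebra.algebraMap_eq_smul_one, smul_mulVec, one_mulVec,
    dotProduct_smul, smul_eq_mul, star_trivial] at this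
  linarith

theorem quadForm_le_of_spectrum (hS : Sᵀ = S) (h : spectrum ℝ S ⊆ Set.Icc a b) (u : Fin n → ℝ) :
    u ⬝ᵥ S *ᵥ u ≤ b * (u ⬝ᵥ u) := by
  have h1 : spectrum ℝ (-S) ⊆ Set.Icc (-b) (-a) := by
    rw [← spectrum.neg_eq]
    intro x hx
    have := h hx
    constructor <;> linarith [this.1, this.2]
  have := le_quadForm_of_spectrum (by rw [transpose_neg, hS]) h1 u
  rw [neg_mulVec, dotProduct_neg] at this
  linarith

theorem isUnit_det_of_spectrum (ha : 0 < a) (h : spectrum ℝ S ⊆ Set.Icc a b) : IsUnit S.det := by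
  rw [← isUnit_iff_isUnit_det, ← spectrum.zero_notMem_iff ℝ]
  exact fun h0 => absurd (h h0).1 (not_le.2 ha)

/-- For the row `u` one has `S u = e_i`, so `a |u|² ≤ u ⬝ᵥ S u = u i ≤ |u|`. -/
theorem row_inv_dotProduct_self_le (hS : Sᵀ = S) (ha : 0 < a) (h : spectrum ℝ S ⊆ Set.Icc a b)
    (i : Fin n) : S⁻¹ i ⬝ᵥ S⁻¹ i ≤ 1 / a ^ 2 := by
  have hdet := isUnit_det_of_spectrum ha h
  set u := S⁻¹ i
  have hu : S *ᵥ u = Pi.single i 1 := by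
    have h1 : S *ᵥ u = (S⁻¹ * S) i := by
      rw [mul_apply_eq_vecMul, ← mulVec_transpose, hS]
    rw [h1, nonsing_inv_mul _ hdet]
    ext j
    simp [one_apply, Pi.single_apply, eq_comm]
  have h2 := le_quadForm_of_spectrum hS h u
  rw [hu, dotProduct_single, mul_one] at h2
  have h3 : u i ^ 2 ≤ u ⬝ᵥ u := by
    rw [sq]
    exact Finset.single_le_sum (f := fun j => u j * u j) (fun j _ => mul_self_nonneg _)
      (Finset.mem_univ i)
  have h0 : 0 ≤ u ⬝ᵥ u := (sq_nonneg _).trans h3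
  have h4 : (a * (u ⬝ᵥ u)) ^ 2 ≤ u ⬝ᵥ u := by
    refine le_trans ?_ h3
    gcongr
  rw [le_div_iff₀ (by positivity)]
  rcases h0.eq_or_lt with h5 | h5
  · rw [← h5]; simp
  · have : (u ⬝ᵥ u) * ((u ⬝ᵥ u) * a ^ 2) ≤ (u ⬝ᵥ u) * 1 := by nlinarith
    exact le_of_mul_le_mul_left this h5

end Spectrum

/-! ### The noise -/

section Noise

theorem lintegral_exp_sum_mul_gaussian {N : ℕ} (x : Fin N → ℝ) {τ : ℝ} (s : ℝ) :
    ∫⁻ e, ENNReal.ofReal (Real.exp (s * ∑ i, x i * e i))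
        ∂(Measure.pi fun _ : Fin N => gaussianReal 0 (τ ^ 2).toNNReal) =
      ENNReal.ofReal (Real.exp (s ^ 2 * τ ^ 2 / 2 * ∑ i, x i ^ 2)) := by
  have hprod : ∀ e : Fin N → ℝ, Real.exp (s * ∑ i, x i * e i) =
      ∏ i, Real.exp (s * x i * e i) := by
    intro e
    rw [← Real.exp_sum, Finset.mul_sum]
    congr 1
    exact Finset.sum_congr rfl fun i _ => by ring
  have hint : Integrable (fun e : Fin N → ℝ => ∏ i, Real.exp (s * x i * e i))
      (Measure.pi fun _ : Fin N => gaussianReal 0 (τ ^ 2).toNNReal) :=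
    Integrable.fintype_prod (f := fun i e => Real.exp (s * x i * e))
      fun i => integrable_exp_mul_gaussianReal _
  simp_rw [hprod]
  rw [← ofReal_integral_eq_lintegral_ofReal hint (Eventually.of_forall fun e => by positivity),
    integral_fintype_prod_eq_prod (fun i e => Real.exp (s * x i * e))]
  congr 1
  have : ∀ i, ∫ e, Real.exp (s * x i * e) ∂gaussianReal 0 (τ ^ 2).toNNReal =
      Real.exp (s ^ 2 * τ ^ 2 / 2 * x i ^ 2) := by
    intro i
    have := congrFun (mgf_id_gaussianReal (μ := 0) (v := (τ ^ 2).toNNReal)) (s * x i)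
    simp only [mgf, id] at this
    rw [this, Real.coe_toNNReal _ (sq_nonneg τ)]
    congr 1; ring
  simp_rw [this]
  rw [← Real.exp_sum, Finset.mul_sum]

variable {Ω : Type*} [MeasurableSpace Ω] {P : Measure Ω} [IsProbabilityMeasure P] {N n : ℕ}
  {X : Ω → Matrix (Fin N) (Fin n) ℝ} {σ : ℝ} {S : Matrix (Fin n) (Fin n) ℝ}
  {ε : Ω → Fin N → ℝ} {τ : ℝ}

theorem IsSubGaussianDesign.lintegral_exp_column (hX : IsSubGaussianDesign P X σ S) (hσ : 0 < σ)
    (j : Fin n) {κ : ℝ} (hκ : 0 ≤ κ) (hκσ : κ ≤ 1 / (4 * σ ^ 2)) :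
    ∫⁻ ω, ENNReal.ofReal (Real.exp (κ * ∑ i, X ω i j ^ 2)) ∂P ≤
      ENNReal.ofReal (Real.exp (N * (2 * σ ^ 2 * κ))) := by
  set c := 1 / (4 * σ ^ 2) with hc
  have hc0 : 0 < c := by positivity
  have hu : (Pi.single j 1 : Fin n → ℝ) ⬝ᵥ Pi.single j 1 = 1 := by simp
  have hent : ∀ i ω, (Pi.single j 1 : Fin n → ℝ) ⬝ᵥ X ω i = X ω i j := fun i ω => by simp
  have hsub : ∀ i, HasSubgaussianMGF (fun ω => X ω i j) (σ ^ 2).toNNReal P := fun i => by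
    simpa only [hent] using (hX.subGaussian i _ hu).2
  have hind : iIndepFun (fun (i : Fin N) ω => X ω i j ^ 2) P := by
    simpa only [hent] using hX.iIndepFun_sq (Pi.single j 1)
  have hm : ∀ i, Measurable fun ω => X ω i j ^ 2 := fun i => (hX.measurable_entry i j).pow_const 2
  have hi : ∀ i, Integrable (fun ω => Real.exp (c * X ω i j ^ 2)) P := fun i =>
    integrable_exp_sq (hX.measurable_entry i j) hσ (hsub i)
  have hiκ : ∀ i, Integrable (fun ω => Real.exp (κ * X ω i j ^ 2)) P := fun i =>
    integrable_exp_mul_of_abs_le (hm i) (fun ω => sq_nonneg _) (hi i) hκσ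
  have hmgf : ∀ i, mgf (fun ω => X ω i j ^ 2) P κ ≤ Real.exp (2 * σ ^ 2 * κ) := by
    intro i
    -- Convexity of `exp` between `0` and `c X²` makes the bound linear in `κ`.
    have hpt : ∀ ω, Real.exp (κ * X ω i j ^ 2) ≤
        (1 - κ / c) + κ / c * Real.exp (c * X ω i j ^ 2) := by
      intro ω
      have := convexOn_exp.2 (Set.mem_univ 0) (Set.mem_univ (c * X ω i j ^ 2))
        (sub_nonneg.2 ((div_le_one hc0).2 hκσ)) (div_nonneg hκ hc0.le) (by ring)
      simp only [smul_eq_mul, mul_zero, zero_add, Real.exp_zero, mul_one] at this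
      rwa [show κ / c * (c * X ω i j ^ 2) = κ * X ω i j ^ 2 by field_simp] at this
    have h1 := integral_mono (hiκ i) ((integrable_const _).add ((hi i).const_mul (κ / c))) hpt
    rw [integral_add' (integrable_const _) ((hi i).const_mul _), integral_const_mul] at h1
    simp only [integral_const, probReal_univ, one_smul] at h1
    have h2 := mul_le_mul_of_nonneg_left
      (integral_exp_sq_le (hX.measurable_entry i j) hσ (hsub i)) (div_nonneg hκ hc0.le)
    have h3 : κ / c * (1 / 2) = 2 * σ ^ 2 * κ := by rw [hc]; field_simp; norm_num
    have h4 := Real.add_one_le_exp (2 * σ ^ 2 * κ)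
    simp only [mgf]
    linarith
  have hint := hind.integrable_exp_mul_sum hm (s := Finset.univ) (t := κ) fun i _ => hiκ i
  have hmg := hind.mgf_sum (t := κ) hm Finset.univ
  simp only [mgf, Finset.sum_apply] at hint hmg
  rw [← ofReal_integral_eq_lintegral_ofReal hint (Eventually.of_forall fun e => by positivity), hmg]
  refine ENNReal.ofReal_le_ofReal ((Finset.prod_le_prod (fun i _ => mgf_nonneg)
    fun i _ => hmgf i).trans_eq ?_)
  rw [Finset.prod_const, Finset.card_univ, Fintype.card_fin, ← Real.exp_nat_mul]

/-- Integrating out the noise first turns the linear form in `ε` into the squared norm of a column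
of `X`, whose exponential moment is already controlled. -/
theorem IsSubGaussianDesign.lintegral_exp_noise (hX : IsSubGaussianDesign P X σ S) (hσ : 0 < σ)
    (hε : HasLaw ε (Measure.pi fun _ => gaussianReal 0 (τ ^ 2).toNNReal) P)
    (hind : IndepFun X ε P) (j : Fin n) {s : ℝ} (hs : s ^ 2 * τ ^ 2 / 2 ≤ 1 / (4 * σ ^ 2)) :
    ∫⁻ ω, ENNReal.ofReal (Real.exp (s * ∑ i, X ω i j * ε ω i)) ∂P ≤
      ENNReal.ofReal (Real.exp (N * (σ ^ 2 * τ ^ 2 * s ^ 2))) := by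
  have hF : Measurable fun p : Matrix (Fin N) (Fin n) ℝ × (Fin N → ℝ) =>
      ENNReal.ofReal (Real.exp (s * ∑ i, p.1 i j * p.2 i)) := by
    have : ∀ i, Measurable fun p : Matrix (Fin N) (Fin n) ℝ × (Fin N → ℝ) => p.1 i j := fun i =>
      (measurable_matrix_entry i j).comp measurable_fst
    fun_prop
  have hXε : AEMeasurable (fun ω => (X ω, ε ω)) P :=
    hX.measurable.aemeasurable.prodMk hε.aemeasurable
  calc ∫⁻ ω, ENNReal.ofReal (Real.exp (s * ∑ i, X ω i j * ε ω i)) ∂P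
      = ∫⁻ p, ENNReal.ofReal (Real.exp (s * ∑ i, p.1 i j * p.2 i))
          ∂(P.map fun ω => (X ω, ε ω)) := (lintegral_map' hF.aemeasurable hXε).symm
    _ = ∫⁻ x, ∫⁻ e, ENNReal.ofReal (Real.exp (s * ∑ i, x i j * e i))
          ∂(P.map ε) ∂(P.map X) := by
        have := Measure.isProbabilityMeasure_map hε.aemeasurable
        rw [(indepFun_iff_map_prod_eq_prod_map_map hX.measurable.aemeasurable
          hε.aemeasurable).1 hind, lintegral_prod _ hF.aemeasurable]
    _ = ∫⁻ ω, ENNReal.ofReal (Real.exp (s ^ 2 * τ ^ 2 / 2 * ∑ i, X ω i j ^ 2)) ∂P := by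
        rw [hε.map_eq]
        have e : ∀ x : Matrix (Fin N) (Fin n) ℝ, _ :=
          fun x => lintegral_exp_sum_mul_gaussian (fun i => x i j) (τ := τ) s
        simp_rw [e]
        refine lintegral_map ?_ hX.measurable
        have : ∀ i, Measurable fun p : Matrix (Fin N) (Fin n) ℝ => p i j := fun i =>
          measurable_matrix_entry i j
        fun_prop
    _ ≤ _ := by
        refine (hX.lintegral_exp_column hσ j (by positivity) hs).trans_eq ?_
        congr 2; ring

/-- The entries of `Xᵀ ε` have sub-exponential tails. -/
theorem IsSubGaussianDesign.measureReal_noise (hX : IsSubGaussianDesign P X σ S) (hσ : 0 < σ)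
    (hτ : 0 < τ) (hε : HasLaw ε (Measure.pi fun _ => gaussianReal 0 (τ ^ 2).toNNReal) P)
    (hind : IndepFun X ε P) (j : Fin n) {a : ℝ} (ha : 0 ≤ a) (haσ : a ^ 2 ≤ 2 * σ ^ 2) :
    P.real {ω | N * (τ * a) ≤ |((X ω)ᵀ *ᵥ ε ω) j|} ≤
      2 * Real.exp (-(N * a ^ 2 / (4 * σ ^ 2))) := by
  -- The minimizer of `σ² τ² s² - s τ a`; the hypothesis `haσ` is exactly what makes it admissible.
  set s := a / (2 * σ ^ 2 * τ) with hs
  have hsq : s ^ 2 * τ ^ 2 / 2 ≤ 1 / (4 * σ ^ 2) := by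
    have : s ^ 2 * τ ^ 2 / 2 = a ^ 2 / (8 * σ ^ 4) := by rw [hs]; field_simp; norm_num
    rw [this, div_le_div_iff₀ (by positivity) (by positivity)]
    nlinarith [sq_nonneg σ]
  have hs0 : 0 ≤ s := by positivity
  have hAE : AEMeasurable (fun ω => ∑ i, X ω i j * ε ω i) P := by
    refine Finset.aemeasurable_fun_sum _ fun i _ => ?_
    exact (hX.measurable_entry i j).aemeasurable.mul
      ((measurable_pi_apply i).comp_aemeasurable hε.aemeasurable)
  have hint : ∀ r : ℝ, r ^ 2 = s ^ 2 →
      Integrable (fun ω => Real.exp (r * ∑ i, X ω i j * ε ω i)) P ∧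
      mgf (fun ω => ∑ i, X ω i j * ε ω i) P r ≤ Real.exp (N * (σ ^ 2 * τ ^ 2 * s ^ 2)) := by
    intro r hr
    have h1 := hX.lintegral_exp_noise hσ hε hind j (s := r) (by rwa [hr])
    rw [hr] at h1
    have h2 : Integrable (fun ω => Real.exp (r * ∑ i, X ω i j * ε ω i)) P := by
      refine ⟨(Real.measurable_exp.comp_aemeasurable
        (hAE.const_mul r)).aestronglyMeasurable, ?_⟩
      rw [hasFiniteIntegral_iff_ofReal (Eventually.of_forall fun g => by positivity)]
      exact h1.trans_lt ENNReal.ofReal_lt_top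
    refine ⟨h2, ?_⟩
    rwa [← ofReal_integral_eq_lintegral_ofReal h2 (Eventually.of_forall fun g => by positivity),
      ENNReal.ofReal_le_ofReal_iff (by positivity)] at h1
  have hexp : -(s * (N * (τ * a))) + N * (σ ^ 2 * τ ^ 2 * s ^ 2) =
      -(N * a ^ 2 / (4 * σ ^ 2)) := by
    rw [hs]; field_simp; ring
  have h1 := measure_ge_le_exp_mul_mgf (N * (τ * a)) hs0 (hint s rfl).1
  have h2 := measure_le_le_exp_mul_mgf (-(N * (τ * a))) (neg_nonpos.2 hs0)
    (hint (-s) (neg_sq s)).1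
  have h1' := h1.trans (mul_le_mul_of_nonneg_left (hint s rfl).2 (Real.exp_pos _).le)
  have h2' := h2.trans (mul_le_mul_of_nonneg_left (hint (-s) (neg_sq s)).2 (Real.exp_pos _).le)
  rw [← Real.exp_add, neg_mul, hexp] at h1'
  rw [← Real.exp_add, neg_neg, mul_neg, hexp] at h2'
  have hsub : {ω | N * (τ * a) ≤ |((X ω)ᵀ *ᵥ ε ω) j|} ⊆
      {ω | N * (τ * a) ≤ ∑ i, X ω i j * ε ω i} ∪ {ω | ∑ i, X ω i j * ε ω i ≤ -(N * (τ * a))} := by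
    intro ω hω
    rw [Set.mem_ofPred_eq] at hω
    have e : ((X ω)ᵀ *ᵥ ε ω) j = ∑ i, X ω i j * ε ω i := rfl
    rw [e] at hω
    rcases le_abs.1 hω with h | h
    · exact Or.inl h
    · right
      rw [Set.mem_ofPred_eq]
      linarith
  refine (measureReal_mono hsub).trans ((measureReal_union_le _ _).trans ?_)
  linarith

end Noise

/-! ### The conditional law of the noise term -/

section CondLaw

variable {N n : ℕ} {m : Type*}

theorem noiseTerm_eq_mulVec (D : Matrix m (Fin n) ℝ) (Θ : Matrix (Fin n) (Fin n) ℝ)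
    (X : Matrix (Fin N) (Fin n) ℝ) (e : Fin N → ℝ) :
    noiseTerm D Θ X e = ((1 / √(N : ℝ)) • (D * Θ * Xᵀ)) *ᵥ e := by
  rw [noiseTerm, smul_mulVec]

theorem sandwich_eq_mul_transpose (D : Matrix m (Fin n) ℝ) (Θ : Matrix (Fin n) (Fin n) ℝ)
    (X : Matrix (Fin N) (Fin n) ℝ) :
    sandwich D Θ X =
      ((1 / √(N : ℝ)) • (D * Θ * Xᵀ)) * ((1 / √(N : ℝ)) • (D * Θ * Xᵀ))ᵀ := by
  have h : (1 / √(N : ℝ)) * (1 / √(N : ℝ)) = 1 / N := by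
    rw [div_mul_div_comm, one_mul, Real.mul_self_sqrt (by positivity)]
  simp only [sandwich, sampleGram, transpose_smul, transpose_mul, transpose_transpose,
    Matrix.smul_mul, Matrix.mul_smul, smul_smul, h, Matrix.mul_assoc]

variable [Fintype m] [DecidableEq m]

theorem map_mulVec_pi_gaussianReal (A : Matrix m (Fin N) ℝ) (τ : ℝ) :
    (Measure.pi fun _ : Fin N => gaussianReal 0 (τ ^ 2).toNNReal).map
        (fun e => WithLp.toLp 2 (A *ᵥ e)) =
      multivariateGaussian 0 (τ ^ 2 • (A * Aᵀ)) := by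
  have hps : (τ ^ 2 • (A * Aᵀ)).PosSemidef := by
    have := (posSemidef_self_mul_conjTranspose A).smul (sq_nonneg τ)
    rwa [conjTranspose_eq_transpose_of_trivial] at this
  have hm : Measurable fun e : Fin N → ℝ => WithLp.toLp 2 (A *ᵥ e) := by
    refine (WithLp.measurable_toLp 2 (m → ℝ)).comp (measurable_pi_lambda _ fun i => ?_)
    simp only [mulVec, dotProduct]
    fun_prop
  have := Measure.isProbabilityMeasure_map hm.aemeasurable
    (μ := Measure.pi fun _ : Fin N => gaussianReal 0 (τ ^ 2).toNNReal)
  refine Measure.ext_of_charFun (E := EuclideanSpace ℝ m) ?_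
  ext t
  rw [charFun_multivariateGaussian hps]
  have h1 : charFun ((Measure.pi fun _ : Fin N => gaussianReal 0 (τ ^ 2).toNNReal).map
        (fun e => WithLp.toLp 2 (A *ᵥ e))) t =
      charFun ((Measure.pi fun _ : Fin N => gaussianReal 0 (τ ^ 2).toNNReal).map (WithLp.toLp 2))
        (WithLp.toLp 2 (Aᵀ *ᵥ t.ofLp)) := by
    rw [charFun_apply, charFun_apply, integral_map hm.aemeasurable (by fun_prop),
      integral_map (by fun_prop) (by fun_prop)]
    congr 1; ext e
    congr 3
    rw [EuclideanSpace.inner_eq_star_dotProduct, EuclideanSpace.inner_eq_star_dotProduct]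
    simp only [star_trivial]
    rw [dotProduct_mulVec, ← mulVec_transpose]
  rw [h1, charFun_pi]
  simp_rw [charFun_gaussianReal]
  rw [← Complex.exp_sum]
  congr 1
  have h2 : t.ofLp ⬝ᵥ (τ ^ 2 • (A * Aᵀ)) *ᵥ t.ofLp = τ ^ 2 * ∑ i, (Aᵀ *ᵥ t.ofLp) i ^ 2 := by
    rw [smul_mulVec, dotProduct_smul, ← mulVec_mulVec, dotProduct_mulVec, ← mulVec_transpose,
      smul_eq_mul]
    simp [dotProduct, sq]
  rw [h2]
  simp only [inner_zero_right, Complex.ofReal_zero, zero_mul, mul_zero, zero_sub,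
    Real.coe_toNNReal _ (sq_nonneg τ)]
  push_cast
  rw [Finset.mul_sum, Finset.sum_div, ← Finset.sum_neg_distrib]

omit [Fintype m] [DecidableEq m] in
theorem measurable_noiseTerm {D : Matrix m (Fin n) ℝ}
    {Θhat : Matrix (Fin N) (Fin n) ℝ → Matrix (Fin n) (Fin n) ℝ} (hΘ : Measurable Θhat) :
    Measurable fun p : Matrix (Fin N) (Fin n) ℝ × (Fin N → ℝ) =>
      WithLp.toLp 2 (noiseTerm D (Θhat p.1) p.1 p.2) := by
  refine (WithLp.measurable_toLp 2 (m → ℝ)).comp (measurable_pi_lambda _ fun i => ?_)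
  have h1 : ∀ a b, Measurable fun p : Matrix (Fin N) (Fin n) ℝ × (Fin N → ℝ) => p.1 a b :=
    fun a b => (measurable_matrix_entry a b).comp measurable_fst
  have h2 : ∀ a b, Measurable fun p : Matrix (Fin N) (Fin n) ℝ × (Fin N → ℝ) => Θhat p.1 a b :=
    fun a b => (measurable_matrix_entry a b).comp (hΘ.comp measurable_fst)
  simp only [noiseTerm, Pi.smul_apply, smul_eq_mul, mulVec, dotProduct, mul_apply, transpose_apply]
  exact (Finset.measurable_fun_sum _ fun a _ => (Finset.measurable_fun_sum _ fun b _ =>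
    (Finset.measurable_fun_sum _ fun c _ => (h2 c b).const_mul _).mul (h1 a b)).mul
      ((measurable_pi_apply a).comp measurable_snd)).const_mul _

/-- The kernel that freezes `x` and integrates over `Z` disintegrates the joint law, and conditional
distributions are almost everywhere unique. -/
theorem condDistrib_comp_of_indepFun {Ω α β γ : Type*} [MeasurableSpace Ω] [MeasurableSpace α]
    [MeasurableSpace β] [MeasurableSpace γ] [StandardBorelSpace γ] [Nonempty γ] {P : Measure Ω}
    [IsProbabilityMeasure P] {X : Ω → α} {Z : Ω → β} (hX : Measurable X) (hZ : AEMeasurable Z P)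
    (hind : IndepFun X Z P) {F : α × β → γ} (hF : Measurable F) :
    ∀ᵐ x ∂(P.map X), condDistrib (fun ω => F (X ω, Z ω)) X P x =
      (P.map Z).map fun z => F (x, z) := by
  have := Measure.isProbabilityMeasure_map hX.aemeasurable (μ := P)
  have := Measure.isProbabilityMeasure_map hZ
  let κ : Kernel α γ := (Kernel.id ×ₖ Kernel.const α (P.map Z)).map F
  have hκ : ∀ x, κ x = (P.map Z).map fun z => F (x, z) := by
    intro x
    rw [Kernel.map_apply _ hF, Kernel.prod_apply, Kernel.id_apply, Kernel.const_apply,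
      Measure.dirac_prod, Measure.map_map hF (by fun_prop)]
    rfl
  have : IsMarkovKernel κ := Kernel.IsMarkovKernel.map _ hF
  have hY : AEMeasurable (fun ω => F (X ω, Z ω)) P :=
    hF.comp_aemeasurable (hX.aemeasurable.prodMk hZ)
  have h : P.map (fun ω => (X ω, F (X ω, Z ω))) = P.map X ⊗ₘ κ := by
    have hG : Measurable fun p : α × β => (p.1, F p) := measurable_fst.prodMk hF
    have e : P.map (fun ω => (X ω, F (X ω, Z ω))) =
        ((P.map X).prod (P.map Z)).map fun p => (p.1, F p) := by
      rw [← (indepFun_iff_map_prod_eq_prod_map_map hX.aemeasurable hZ).1 hind,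
        AEMeasurable.map_map_of_aemeasurable hG.aemeasurable (hX.aemeasurable.prodMk hZ)]
      rfl
    rw [e]
    ext s hs
    rw [Measure.map_apply hG hs, Measure.prod_apply (hG hs), Measure.compProd_apply hs]
    refine lintegral_congr fun x => ?_
    have hFx : Measurable fun z => F (x, z) := hF.comp measurable_prodMk_left
    rw [hκ, Measure.map_apply hFx (measurable_prodMk_left hs)]
    rfl
  filter_upwards [condDistrib_ae_eq_of_measure_eq_compProd (μ := P) X hY h] with x hx
  rw [hx, hκ]

theorem condDistrib_noiseTerm {Ω : Type*} [MeasurableSpace Ω] {P : Measure Ω}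
    [IsProbabilityMeasure P] {X : Ω → Matrix (Fin N) (Fin n) ℝ} {ε : Ω → Fin N → ℝ} {τ : ℝ}
    (hX : Measurable X) (hε : HasLaw ε (Measure.pi fun _ => gaussianReal 0 (τ ^ 2).toNNReal) P)
    (hind : IndepFun X ε P) (D : Matrix m (Fin n) ℝ)
    {Θhat : Matrix (Fin N) (Fin n) ℝ → Matrix (Fin n) (Fin n) ℝ} (hΘ : Measurable Θhat) :
    ∀ᵐ x ∂(P.map X),
      condDistrib (fun ω => WithLp.toLp 2 (noiseTerm D (Θhat (X ω)) (X ω) (ε ω))) X P x =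
        multivariateGaussian 0 (τ ^ 2 • sandwich D (Θhat x) x) := by
  filter_upwards [condDistrib_comp_of_indepFun hX hε.aemeasurable hind
    (measurable_noiseTerm (D := D) hΘ)] with x hx
  rw [hx, hε.map_eq, sandwich_eq_mul_transpose, ← map_mulVec_pi_gaussianReal]
  simp_rw [noiseTerm_eq_mulVec]

end CondLaw

/-! ### Union bounds -/

theorem measureReal_exists_le {Ω ι : Type*} [MeasurableSpace Ω] {P : Measure Ω}
    [IsProbabilityMeasure P] [Fintype ι] {p : ι → Ω → Prop} {B : ℝ}
    (h : ∀ i, P.real {ω | p i ω} ≤ B) : P.real {ω | ∃ i, p i ω} ≤ Fintype.card ι * B := by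
  have e : {ω | ∃ i, p i ω} = ⋃ i ∈ (Finset.univ : Finset ι), {ω | p i ω} := by
    ext ω; simp
  rw [e]
  refine (measureReal_biUnion_finset_le _ _).trans ((Finset.sum_le_sum fun i _ => h i).trans_eq ?_)
  simp

theorem natCast_pow_mul_exp_le_inv {n a : ℕ} (hn : 0 < n) {x : ℝ}
    (hx : (a + 1) * Real.log n ≤ x) : (n : ℝ) ^ a * Real.exp (-x) ≤ 1 / n := by
  have hn' : (0 : ℝ) < n := by exact_mod_cast hn
  have h1 : Real.exp (-x) ≤ ((n : ℝ) ^ (a + 1))⁻¹ := by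
    rw [Real.exp_neg]
    refine inv_anti₀ (by positivity) ?_
    rw [← Real.exp_log (pow_pos hn' _), Real.log_pow]
    exact Real.exp_le_exp.2 (by push_cast; exact hx)
  refine (mul_le_mul_of_nonneg_left h1 (by positivity)).trans_eq ?_
  rw [pow_succ]; field_simp

theorem natCast_mul_sqrt_sq {N : ℕ} (hN : 0 < N) (n : ℕ) (c : ℝ) :
    N * (c * √(Real.log n / N)) ^ 2 = c ^ 2 * Real.log n := by
  have hN' : (0 : ℝ) < N := by exact_mod_cast hN
  rw [mul_pow, Real.sq_sqrt (div_nonneg (Real.log_natCast_nonneg n) hN'.le)]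
  field_simp

/-! ### High-probability events for the design and the noise -/

section Events

variable {Ω : Type*} [MeasurableSpace Ω] {P : Measure Ω} [IsProbabilityMeasure P] {N n : ℕ}
  {X : Ω → Matrix (Fin N) (Fin n) ℝ} {σ : ℝ} {S : Matrix (Fin n) (Fin n) ℝ} {a b : ℝ}

theorem four_mul_dotProduct_mulVec {K : Matrix (Fin n) (Fin n) ℝ} (hK : Kᵀ = K)
    (u v : Fin n → ℝ) : 4 * (u ⬝ᵥ K *ᵥ v) =
      (v + u) ⬝ᵥ K *ᵥ (v + u) - (v + -u) ⬝ᵥ K *ᵥ (v + -u) := by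
  rw [quadForm_add hK, quadForm_add hK]
  simp only [neg_dotProduct, mulVec_neg, dotProduct_neg]
  ring

/-- The entry is the bilinear form of `Σ_N - S` at row `i` of `S⁻¹` and `e_j`, so polarization
reduces it to two quadratic forms at `e_j ± S⁻¹ i`. -/
theorem abs_inv_mul_sampleGram_sub_le (hSdet : IsUnit S.det) (hS : Sᵀ = S) (ha : 0 < a)
    (hsp : spectrum ℝ S ⊆ Set.Icc a b) {x : Matrix (Fin N) (Fin n) ℝ} {t : ℝ} (ht : 0 ≤ t)
    {i j : Fin n}
    (h : ∀ s : Bool, |(Pi.single j 1 + (if s then S⁻¹ i else -S⁻¹ i)) ⬝ᵥ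
        sampleGram x *ᵥ (Pi.single j 1 + (if s then S⁻¹ i else -S⁻¹ i)) -
      (Pi.single j 1 + (if s then S⁻¹ i else -S⁻¹ i)) ⬝ᵥ
        S *ᵥ (Pi.single j 1 + (if s then S⁻¹ i else -S⁻¹ i))| ≤
      t * ((Pi.single j 1 + (if s then S⁻¹ i else -S⁻¹ i)) ⬝ᵥ
        (Pi.single j 1 + (if s then S⁻¹ i else -S⁻¹ i)))) :
    |(S⁻¹ * sampleGram x - 1) i j| ≤ t * (1 + 1 / a ^ 2) := by
  have hK : (sampleGram x - S)ᵀ = sampleGram x - S := by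
    rw [transpose_sub, sampleGram_transpose, hS]
  have e1 : (S⁻¹ * sampleGram x - 1) i j =
      S⁻¹ i ⬝ᵥ (sampleGram x - S) *ᵥ (Pi.single j 1) := by
    rw [← nonsing_inv_mul _ hSdet, ← Matrix.mul_sub, mulVec_single_one]
    rfl
  have e2 := four_mul_dotProduct_mulVec hK (S⁻¹ i) (Pi.single j 1)
  rw [← e1] at e2
  have h1 := h true
  have h2 := h false
  simp only [if_true, Bool.false_eq_true, if_false, ← dotProduct_sub, ← sub_mulVec] at h1 h2
  have e3 : ((Pi.single j 1 : Fin n → ℝ) + S⁻¹ i) ⬝ᵥ (Pi.single j 1 + S⁻¹ i) +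
      ((Pi.single j 1 : Fin n → ℝ) + -S⁻¹ i) ⬝ᵥ (Pi.single j 1 + -S⁻¹ i) =
      2 * (1 + S⁻¹ i ⬝ᵥ S⁻¹ i) := by
    simp only [add_dotProduct, dotProduct_add, neg_dotProduct, dotProduct_neg,
      single_dotProduct, dotProduct_single, Pi.add_apply, Pi.neg_apply, Pi.single_eq_same]
    ring
  have h3 := row_inv_dotProduct_self_le hS ha hsp i
  have h4 : t * (2 * (1 + S⁻¹ i ⬝ᵥ S⁻¹ i)) ≤ t * (2 * (1 + 1 / a ^ 2)) := by gcongr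
  rw [← e3, mul_add] at h4
  have h5 : 0 ≤ t * (1 + 1 / a ^ 2) := by positivity
  rw [abs_le] at h1 h2 ⊢
  constructor <;> linarith [h1.1, h1.2, h2.1, h2.2]

/-- With high probability, the inverse covariance matrix is feasible for the CLIME program. -/
theorem IsSubGaussianDesign.measureReal_not_climeFeasible (hX : IsSubGaussianDesign P X σ S)
    (hσ : 0 < σ) (hN : 0 < N) (hn : 0 < n) (ha : 0 < a) (hsp : spectrum ℝ S ⊆ Set.Icc a b)
    {μ : ℝ} (hμ : (10 * σ ^ 2 * (1 + 1 / a ^ 2) + 5 / 2) * √(Real.log n / N) ≤ μ) :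
    P.real {ω | ¬ (1 ≤ μ ∨ ClimeFeasible (sampleGram (X ω)) μ S⁻¹)} ≤ 4 / n := by
  set ρ := √(Real.log n / N) with hρ
  have hρ0 : 0 ≤ ρ := Real.sqrt_nonneg _
  have hL : 0 ≤ 1 + 1 / a ^ 2 := by positivity
  by_cases h1 : 1 ≤ μ
  · simp only [h1, true_or, not_true_eq_false]
    rw [Set.ofPred_false, measureReal_empty]
    positivity
  have hS := hX.transpose_cov hN
  set t := 10 * σ ^ 2 * ρ with ht
  have ht0 : 0 ≤ t := by positivity
  have htL : t * (1 + 1 / a ^ 2) ≤ μ := by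
    refine le_trans ?_ hμ
    rw [ht]
    nlinarith
  -- The summand `5 / 2` in the threshold serves this: with `μ < 1` it gives `ρ ≤ 2 / 5`, the range
  -- where concentration holds.
  have ht4 : t ≤ 4 * σ ^ 2 := by
    have : 5 / 2 * ρ ≤ 1 := by
      have : 0 ≤ 10 * σ ^ 2 * (1 + 1 / a ^ 2) * ρ := by positivity
      linarith
    rw [ht]
    nlinarith [sq_nonneg σ]
  have hμ0 : 0 ≤ μ := le_trans (by positivity) hμ
  let w : Fin n × Fin n × Bool → Fin n → ℝ := fun p =>
    Pi.single p.2.1 1 + (if p.2.2 then S⁻¹ p.1 else -S⁻¹ p.1)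
  have hb := measureReal_exists_le (P := P)
    (p := fun p ω => t * (w p ⬝ᵥ w p) < |w p ⬝ᵥ sampleGram (X ω) *ᵥ w p - w p ⬝ᵥ S *ᵥ w p|)
    fun p => hX.measureReal_quadForm hσ hN (w p) ht0 ht4
  refine (measureReal_mono ?_).trans (hb.trans ?_)
  · intro ω hω
    rw [Set.mem_ofPred_eq] at hω ⊢
    by_contra! hcon
    refine hω (Or.inr (matMax_le hμ0 fun i j => ?_))
    exact (abs_inv_mul_sampleGram_sub_le (isUnit_det_of_spectrum ha hsp) hS ha hsp ht0
      fun s => hcon (i, j, s)).trans htL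
  -- The exponent is `(100 / 32) log n`, enough to absorb the `2 n²` vectors and leave a factor `1 /
  -- n`.
  · have hx : ((2 : ℕ) + 1) * Real.log n ≤ N * t ^ 2 / (32 * σ ^ 4) := by
      rw [ht, natCast_mul_sqrt_sq hN, le_div_iff₀ (by positivity)]
      have := Real.log_natCast_nonneg n
      have : 0 ≤ σ ^ 4 * Real.log n := by positivity
      push_cast
      nlinarith
    have := natCast_pow_mul_exp_le_inv hn hx
    simp only [Fintype.card_prod, Fintype.card_fin, Fintype.card_bool]
    push_cast
    calc _ = 4 * ((n : ℝ) ^ 2 * Real.exp (-(N * t ^ 2 / (32 * σ ^ 4)))) := by ring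
      _ ≤ 4 * (1 / n) := by gcongr
      _ = 4 / n := by ring

/-- With high probability, the diagonal of the sample Gram matrix is bounded. -/
theorem IsSubGaussianDesign.measureReal_diag (hX : IsSubGaussianDesign P X σ S)
    (hσ : 0 < σ) (hN : 0 < N) (hn : 0 < n) (hsp : spectrum ℝ S ⊆ Set.Icc a b)
    (hNn : 4 * Real.log n ≤ N) :
    P.real {ω | ∃ j, b + 4 * σ ^ 2 < sampleGram (X ω) j j} ≤ 2 / n := by
  have hb := measureReal_exists_le (P := P) (p := fun (j : Fin n) ω =>
    4 * σ ^ 2 * ((Pi.single j 1 : Fin n → ℝ) ⬝ᵥ Pi.single j 1) <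
      |(Pi.single j 1 : Fin n → ℝ) ⬝ᵥ sampleGram (X ω) *ᵥ Pi.single j 1 -
        (Pi.single j 1 : Fin n → ℝ) ⬝ᵥ S *ᵥ Pi.single j 1|)
    fun j => hX.measureReal_quadForm hσ hN _ (by positivity) le_rfl
  refine (measureReal_mono ?_).trans (hb.trans ?_)
  · intro ω hω
    rw [Set.mem_ofPred_eq] at hω ⊢
    obtain ⟨j, hj⟩ := hω
    refine ⟨j, ?_⟩
    have h1 := quadForm_le_of_spectrum (hX.transpose_cov hN) hsp (Pi.single j 1)
    simp only [single_dotProduct, mulVec_single, Pi.single_eq_same, one_mul, mul_one,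
      MulOpposite.op_one, one_smul, col_apply] at h1 ⊢
    exact lt_of_lt_of_le (by linarith) (le_abs_self _)
  · have e : N * (4 * σ ^ 2) ^ 2 / (32 * σ ^ 4) = (N : ℝ) / 2 := by field_simp; norm_num
    have := natCast_pow_mul_exp_le_inv (a := 1) hn
      (x := N * (4 * σ ^ 2) ^ 2 / (32 * σ ^ 4)) (by rw [e]; push_cast; linarith)
    rw [Fintype.card_fin]
    calc _ = 2 * ((n : ℝ) ^ 1 * Real.exp (-(N * (4 * σ ^ 2) ^ 2 / (32 * σ ^ 4)))) := by ring
      _ ≤ 2 * (1 / n) := by gcongr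
      _ = 2 / n := by ring

/-- With high probability, the sample Gram matrix is well conditioned in the directions of all
sums of a given number of signed basis vectors. -/
theorem IsSubGaussianDesign.measureReal_signedSum (hX : IsSubGaussianDesign P X σ S)
    (hσ : 0 < σ) (hN : 0 < N) (hn : 2 ≤ n) (hsp : spectrum ℝ S ⊆ Set.Icc a b) {m : ℕ} {t : ℝ}
    (ht : 0 ≤ t) (hta : t ≤ a / 2) (htσ : t ≤ 4 * σ ^ 2)
    (hNn : (2 * m + 1) * Real.log n ≤ N * t ^ 2 / (32 * σ ^ 4)) :
    P.real {ω | ∃ f : Fin m → Fin n × Bool,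
      signedSum f ⬝ᵥ sampleGram (X ω) *ᵥ signedSum f < a / 2 * (signedSum f ⬝ᵥ signedSum f)} ≤
      2 / n := by
  have hb := measureReal_exists_le (P := P) (p := fun (f : Fin m → Fin n × Bool) ω =>
    t * (signedSum f ⬝ᵥ signedSum f) <
      |signedSum f ⬝ᵥ sampleGram (X ω) *ᵥ signedSum f - signedSum f ⬝ᵥ S *ᵥ signedSum f|)
    fun f => hX.measureReal_quadForm hσ hN _ ht htσ
  refine (measureReal_mono ?_).trans (hb.trans ?_)
  · intro ω hω
    rw [Set.mem_ofPred_eq] at hω ⊢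
    obtain ⟨f, hf⟩ := hω
    refine ⟨f, lt_of_lt_of_le ?_ (neg_le_abs _)⟩
    have h1 := le_quadForm_of_spectrum (hX.transpose_cov hN) hsp (signedSum f)
    have h0 : (0 : ℝ) ≤ signedSum f ⬝ᵥ signedSum f :=
      Finset.sum_nonneg fun i _ => mul_self_nonneg _
    nlinarith
  · have h1 := natCast_pow_mul_exp_le_inv (a := 2 * m) (by omega : 0 < n)
      (by push_cast; exact hNn)
    have h2 : ((n * 2 : ℕ) : ℝ) ^ m ≤ (n : ℝ) ^ (2 * m) := by
      rw [pow_mul]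
      have : (2 : ℝ) ≤ n := by exact_mod_cast hn
      gcongr
      push_cast
      nlinarith
    simp only [Fintype.card_pi, Fintype.card_prod, Fintype.card_fin, Fintype.card_bool,
      Finset.prod_const, Finset.card_univ, Nat.cast_pow]
    calc _ = 2 * (((n * 2 : ℕ) : ℝ) ^ m * Real.exp (-(N * t ^ 2 / (32 * σ ^ 4)))) := by ring
      _ ≤ 2 * ((n : ℝ) ^ (2 * m) * Real.exp (-(N * t ^ 2 / (32 * σ ^ 4)))) := by gcongr
      _ ≤ 2 * (1 / n) := by gcongr
      _ = 2 / n := by ring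

/-- With high probability, the noise is dominated by the tuning parameter. -/
theorem IsSubGaussianDesign.measureReal_noise_le (hX : IsSubGaussianDesign P X σ S)
    (hσ : 0 < σ) (hN : 0 < N) (hn : 0 < n) {ε : Ω → Fin N → ℝ} {τ : ℝ} (hτ : 0 < τ)
    (hε : HasLaw ε (Measure.pi fun _ => gaussianReal 0 (τ ^ 2).toNNReal) P)
    (hind : IndepFun X ε P) {lam : ℝ} (hlam : 6 * σ * (τ * √(Real.log n / N)) ≤ lam)
    (hNn : 5 * Real.log n ≤ N) :
    P.real {ω | ∃ j, N * (lam / 2) < |((X ω)ᵀ *ᵥ ε ω) j|} ≤ 2 / n := by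
  have hN' : (0 : ℝ) < N := by exact_mod_cast hN
  have hlog := Real.log_natCast_nonneg n
  set t := 3 * σ * √(Real.log n / N) with ht
  have hNt : N * t ^ 2 = 9 * σ ^ 2 * Real.log n := by
    rw [ht, natCast_mul_sqrt_sq hN]; ring
  have hb := measureReal_exists_le (P := P)
    (p := fun (j : Fin n) ω => N * (τ * t) ≤ |((X ω)ᵀ *ᵥ ε ω) j|)
    fun j => hX.measureReal_noise hσ hτ hε hind j (a := t) (by positivity) (by
      have : N * t ^ 2 ≤ N * (2 * σ ^ 2) := by
        rw [hNt]
        have : σ ^ 2 * (5 * Real.log n) ≤ σ ^ 2 * N := by gcongr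
        have : 0 ≤ σ ^ 2 * N := by positivity
        linarith
      exact le_of_mul_le_mul_left this hN')
  refine (measureReal_mono ?_).trans (hb.trans ?_)
  · intro ω hω
    rw [Set.mem_ofPred_eq] at hω ⊢
    obtain ⟨j, hj⟩ := hω
    refine ⟨j, le_trans ?_ hj.le⟩
    gcongr
    rw [ht]; linarith
  · have h1 := natCast_pow_mul_exp_le_inv (a := 1) hn (x := N * t ^ 2 / (4 * σ ^ 2)) (by
      rw [hNt, le_div_iff₀ (by positivity)]
      have : 0 ≤ σ ^ 2 * Real.log n := by positivity
      push_cast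
      linarith)
    rw [Fintype.card_fin]
    calc _ = 2 * ((n : ℝ) ^ 1 * Real.exp (-(N * t ^ 2 / (4 * σ ^ 2)))) := by ring
      _ ≤ 2 * (1 / n) := by gcongr
      _ = 2 / n := by ring

end Events

/-! ### Deterministic error bounds -/

section Deterministic

variable {N n : ℕ}

theorem IsClime.matMax_sandwich_sub_le {m : Type*} [Fintype m] {D : Matrix m (Fin n) ℝ} {r : ℝ}
    (hr : 0 ≤ r) (hD : ∀ i, ∑ j, |D i j| ≤ r) {X : Matrix (Fin N) (Fin n) ℝ}
    {Θ T : Matrix (Fin n) (Fin n) ℝ} {μ M : ℝ} (hT : Tᵀ = T) (hM : opInf T ≤ M)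
    (hM0 : 0 ≤ M) (h : IsClime (sampleGram X) μ Θ)
    (hfeas : 1 ≤ μ ∨ ClimeFeasible (sampleGram X) μ T) :
    matMax (sandwich D Θ X - D * T * Dᵀ) ≤ r ^ 2 * (3 * (μ * M)) := by
  have hμ : 0 ≤ μ := (matMax_nonneg _).trans h.1
  have e : sandwich D Θ X - D * T * Dᵀ = D * (Θ * sampleGram X * Θᵀ - T) * Dᵀ := by
    simp only [sandwich, Matrix.mul_sub, Matrix.sub_mul, Matrix.mul_assoc]
  rw [e]
  refine matMax_le (by positivity) fun i j =>
    abs_mul_mul_transpose_le (by positivity) hr (fun i j => ?_) hD i j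
  rcases hfeas with h1 | h1
  · rw [h.eq_zero h1, Matrix.zero_mul, Matrix.zero_mul, zero_sub, neg_apply, abs_neg]
    have h2 : |T i j| ≤ M := (Finset.single_le_sum (f := fun j => |T i j|)
      (fun j _ => abs_nonneg _) (Finset.mem_univ j)).trans ((row_sum_le_opInf T i).trans hM)
    nlinarith
  · exact h.abs_sandwich_sub_le (sampleGram_transpose X) hT h1 hM i j

theorem IsGraphLasso.l1_sub_le (hN : 0 < N) {G : SimpleGraph (Fin n)} [DecidableRel G.Adj]
    (hd : 0 < G.maxDegree) {k : ℕ} {lamG lam ν : ℝ} (hlam : 0 < lam) (hν : 0 ≤ ν)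
    (hlamG : lamG = lam * √(ν / (2 * (G.maxDegree : ℝ)) ^ (k + 1)))
    {X : Matrix (Fin N) (Fin n) ℝ} {βstar β : Fin n → ℝ} {ε : Fin N → ℝ} {s₁ s₂ : ℕ}
    (hs₂0 : 0 < s₂) (hs₁ : l0 (diffOp G k *ᵥ βstar) ≤ s₁) (hs₂ : l0 βstar ≤ s₂)
    (hs : ν * s₁ ≤ s₂) (hβ : IsGraphLasso G k lamG lam X (response X βstar ε) β)
    (hnoise : ∀ j, |(Xᵀ *ᵥ ε) j| ≤ N * (lam / 2)) {c C : ℝ} (hc : 0 < c) (hC0 : 0 ≤ C)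
    (hC : ∀ j, sampleGram X j j ≤ C) {R : ℕ} (hR0 : 0 < R) (hR : 72 * C ≤ c * R)
    (hre : ∀ f : Fin (R * s₂ + 1) → Fin n × Bool,
      c * (signedSum f ⬝ᵥ signedSum f) ≤ signedSum f ⬝ᵥ sampleGram X *ᵥ signedSum f) :
    l1 (β - βstar) ≤ 72 * lam * s₂ / c := by
  have hd' : (0 : ℝ) < G.maxDegree := by exact_mod_cast hd
  have hbasic := lasso_basic_inequality hN hlam.le hν (B := (2 * (G.maxDegree : ℝ)) ^ (k + 1))
    (by positivity) hlamG (fun v => sum_sq_diffOp_mulVec_le G v k) hs₁ hs₂ hs (hβ βstar) hnoise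
  have hlow := l1_sq_lower_bound_of_forall_signedSum (sampleGram_transpose X) hc.le hC
    (Nat.succ_pos _) hre (β - βstar)
  refine l1_le_of_basic_inequality hlam hc hs₂0 hR ?_ hbasic ?_ hR0 hC0
  · rw [quadForm_sampleGram]
    have := Finset.sum_nonneg fun i (_ : i ∈ Finset.univ) => sq_nonneg ((X *ᵥ (β - βstar)) i)
    positivity
  · push_cast at hlow
    rwa [add_sub_cancel_right] at hlow

end Deterministic

/-- The bad events have vanishing probability, so one constant `K` serves every `δ`. -/
theorem isBigOInProb_of_measureReal_le {Ω : ℕ → Type*} [∀ t, MeasurableSpace (Ω t)]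
    {P : ∀ t, Measure (Ω t)} [∀ t, IsProbabilityMeasure (P t)] {Y : ∀ t, Ω t → ℝ} {a : ℕ → ℝ}
    {n : ℕ → ℕ} (hn : Tendsto n atTop atTop) {K C : ℝ} (hK : 0 < K) (bad : ∀ t, Set (Ω t))
    (hbad : ∀ᶠ t in atTop, (P t).real (bad t) ≤ C / n t)
    (h : ∀ t, ∀ᵐ ω ∂(P t), ω ∉ bad t → |Y t ω| ≤ K * a t) : IsBigOInProb P Y a := by
  intro δ hδ
  refine ⟨K, hK, ?_⟩
  have h0 : Tendsto (fun t => C / (n t : ℝ)) atTop (nhds 0) :=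
    (tendsto_const_div_atTop_nhds_zero_nat C).comp hn
  filter_upwards [hbad, h0.eventually (gt_mem_nhds hδ)] with t h1 h2
  have h3 : P t {ω | K * a t < |Y t ω|} ≤ P t (bad t) := by
    refine measure_mono_ae ?_
    filter_upwards [h t] with ω hω
    intro hlt
    by_contra hnot
    exact absurd (hω hnot) (not_le.2 hlt)
  refine h3.trans ?_
  rw [← ofReal_measureReal]
  exact ENNReal.ofReal_le_ofReal (h1.trans h2.le)

end GPPL

/-! ### Choice of constants and assembly -/

theorem corollary1 (σx cmin cmax ν : ℝ) (hσx : 0 < σx) (hcmin : 0 < cmin)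
    (hν : 0 ≤ ν) (hν1 : ν < 1) :
    -- thresholds for the tuning constants and the sample size
    ∃ cLam cMu κ : ℝ, 0 < cLam ∧ 0 < cMu ∧ 0 < κ ∧
    ∀ (k : ℕ) (CLam CMu : ℝ)
      -- a sequence of regression problems: `N t` observations, a graph with `n t` nodes
      (n N s₁ s₂ : ℕ → ℕ) (G : ∀ t, SimpleGraph (Fin (n t))) [∀ t, DecidableRel (G t).Adj]
      (Ω : ℕ → Type*) [∀ t, MeasurableSpace (Ω t)]
      (P : ∀ t, Measure (Ω t)) [∀ t, IsProbabilityMeasure (P t)]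
      (X : ∀ t, Ω t → Matrix (Fin (N t)) (Fin (n t)) ℝ) (ε : ∀ t, Ω t → Fin (N t) → ℝ)
      (S : ∀ t, Matrix (Fin (n t)) (Fin (n t)) ℝ) (βstar : ∀ t, Fin (n t) → ℝ)
      (σε M lam lamG μ : ℕ → ℝ)
      (βhat : ∀ t, Ω t → Fin (n t) → ℝ)
      (Θhat : ∀ t, Matrix (Fin (N t)) (Fin (n t)) ℝ → Matrix (Fin (n t)) (Fin (n t)) ℝ),
      Tendsto n atTop atTop →
      (∀ t, 0 < N t) →
      -- the maximum degree is at least two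
      (∀ t, 2 ≤ (G t).maxDegree) →
      -- the true coefficients are simultaneously piecewise polynomial and sparse
      (∀ t, 0 < s₁ t ∧ 0 < s₂ t) →
      (∀ t, l0 (diffOp (G t) k *ᵥ βstar t) ≤ s₁ t ∧ l0 (βstar t) ≤ s₂ t) →
      (∀ t, ν ≤ (s₂ t : ℝ) / s₁ t) →
      -- sub-Gaussian design with bounded eigenvalues of the covariance matrix
      (∀ t, IsSubGaussianDesign (P t) (X t) σx (S t)) →
      (∀ t, spectrum ℝ (S t) ⊆ Set.Icc cmin cmax) →
      (∀ t, opInf (S t)⁻¹ ≤ M t) →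
      -- Gaussian noise, independent of the design
      (∀ t, 0 < σε t) →
      (∀ t, HasLaw (ε t) (Measure.pi fun _ => gaussianReal 0 (σε t ^ 2).toNNReal) (P t)) →
      (∀ t, IndepFun (X t) (ε t) (P t)) →
      -- tuning parameters
      (∀ t, cLam * (σε t * √(Real.log (n t) / N t)) ≤ lam t ∧
        lam t ≤ CLam * (σε t * √(Real.log (n t) / N t))) →
      (∀ t, lamG t = lam t * √(ν / (2 * ((G t).maxDegree : ℝ)) ^ (k + 1))) →
      (∀ t, cMu * √(Real.log (n t) / N t) ≤ μ t ∧ μ t ≤ CMu * √(Real.log (n t) / N t)) →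
      -- the initial estimator
      (∀ t, ∀ᵐ ω ∂(P t), IsGraphLasso (G t) k (lamG t) (lam t) (X t ω)
        (response (X t ω) (βstar t) (ε t ω)) (βhat t ω)) →
      -- the CLIME estimator, a measurable function of the design that solves the program
      -- whenever the program is feasible
      (∀ t, Measurable (Θhat t)) →
      (∀ t, ∀ᵐ ω ∂(P t), (∃ Θ, ClimeFeasible (sampleGram (X t ω)) (μ t) Θ) →
        IsClime (sampleGram (X t ω)) (μ t) (Θhat t (X t ω))) →
      -- the decomposition
      (∀ t ω, √(N t : ℝ) • (diffOp (G t) k *ᵥ oneStep (Θhat t (X t ω)) (X t ω)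
            (response (X t ω) (βstar t) (ε t ω)) (βhat t ω) - diffOp (G t) k *ᵥ βstar t) =
          noiseTerm (diffOp (G t) k) (Θhat t (X t ω)) (X t ω) (ε t ω) -
            remainder (diffOp (G t) k) (Θhat t (X t ω)) (X t ω) (βhat t ω) (βstar t)) ∧
      -- the conditional law of the noise term given the design
      (∀ t, ∀ᵐ x ∂((P t).map (X t)),
        condDistrib (fun ω => WithLp.toLp 2
            (noiseTerm (diffOp (G t) k) (Θhat t (X t ω)) (X t ω) (ε t ω))) (X t) (P t) x =
          multivariateGaussian 0 (σε t ^ 2 • sandwich (diffOp (G t) k) (Θhat t x) x)) ∧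
      -- the size of the remainder
      ((∀ᶠ t in atTop, κ * (s₂ t * Real.log (n t)) ≤ N t) →
        IsBigOInProb P
          (fun t ω => vecMax
            (remainder (diffOp (G t) k) (Θhat t (X t ω)) (X t ω) (βhat t ω) (βstar t)))
          (fun t => σε t * (2 * ((G t).maxDegree : ℝ)) ^ (((k : ℝ) + 1) / 2) *
            (s₂ t * Real.log (n t) / √(N t : ℝ)))) ∧
      -- the sandwich covariance
      IsBigOInProb P
        (fun t ω => matMax (sandwich (diffOp (G t) k) (Θhat t (X t ω)) (X t ω) -
          diffOp (G t) k * (S t)⁻¹ * (diffOp (G t) k)ᵀ))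
        (fun t => (2 * ((G t).maxDegree : ℝ)) ^ (k + 1) * M t *
          √(Real.log (n t) / N t)) := by
  -- `R + 1` is used below as the ratio of sparsity levels, so that it is positive; `|cmax|` spares
  -- a sign assumption on `cmax`.
  obtain ⟨R, hR⟩ := exists_nat_ge (72 * (|cmax| + 4 * σx ^ 2) / (cmin / 2))
  set t₀ := min (cmin / 2) (4 * σx ^ 2) with ht₀
  have ht₀pos : 0 < t₀ := lt_min (by positivity) (by positivity)
  -- This pays for the union bound over sums of `m = (R + 1) s₂ + 1` signed basis vectors, since `2m
  -- + 1 ≤ (2(R + 2) + 1) s₂`. The extra `5` in `κ` covers the diagonal and noise events.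
  set κ₀ := (2 * ((R + 1 : ℕ) + 1 : ℝ) + 1) * (32 * σx ^ 4) / t₀ ^ 2 with hκ₀
  have hκ₀pos : 0 < κ₀ := by positivity
  have hR' : 72 * (|cmax| + 4 * σx ^ 2) ≤ cmin / 2 * (R + 1 : ℕ) := by
    rw [div_le_iff₀ (by positivity)] at hR
    push_cast
    nlinarith
  refine ⟨6 * σx, 10 * σx ^ 2 * (1 + 1 / cmin ^ 2) + 5 / 2, κ₀ + 5, by positivity, by positivity,
    by positivity, ?_⟩
  intro k CLam CMu n N s₁ s₂ G _ Ω _ P _ X ε S βstar σε M lam lamG μ βhat Θhat hn hN hd hs0 hl0 hs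
    hX hsp hM hσε hε hind hlam hlamG hμ hβ hΘm hΘ
  have hn2 : ∀ t, 2 ≤ n t := by
    intro t
    have : Nonempty (Fin (n t)) := by
      by_contra h
      rw [not_nonempty_iff] at h
      have h1 := (G t).maxDegree_of_subsingleton
      have h2 := hd t
      omega
    obtain ⟨v, hv⟩ := (G t).exists_maximal_degree_vertex
    have h1 := (G t).degree_lt_card_verts v
    have h2 := hd t
    rw [Fintype.card_fin] at h1
    omega
  have hNpos : ∀ t, (0 : ℝ) < N t := fun t => by exact_mod_cast hN t
  have hlog : ∀ t, 0 < Real.log (n t) := fun t => Real.log_pos (by exact_mod_cast hn2 t)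
  have hρ : ∀ t, 0 < √(Real.log (n t) / N t) := fun t =>
    Real.sqrt_pos.2 (div_pos (hlog t) (hNpos t))
  have hST : ∀ t, (S t)ᵀ = S t := fun t => (hX t).transpose_cov (hN t)
  have hfeas := fun t => (hX t).measureReal_not_climeFeasible hσx (hN t)
    (lt_of_lt_of_le two_pos (hn2 t)) hcmin (hsp t) (hμ t).1
  have hclime : ∀ t, ∀ᵐ ω ∂(P t),
      (1 ≤ μ t ∨ ClimeFeasible (sampleGram (X t ω)) (μ t) (S t)⁻¹) →
        IsClime (sampleGram (X t ω)) (μ t) (Θhat t (X t ω)) := by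
    intro t
    filter_upwards [hΘ t] with ω hω h
    exact hω (h.elim (fun h1 => ⟨0, climeFeasible_zero h1⟩) fun h1 => ⟨_, h1⟩)
  have hMnn : ∀ t, 0 ≤ M t := fun t =>
    (Real.iSup_nonneg fun _ => Finset.sum_nonneg fun _ _ => abs_nonneg _).trans (hM t)
  have hCMu : 0 < CMu := by
    have h := (hμ 0).1.trans (hμ 0).2
    have : 0 < 10 * σx ^ 2 * (1 + 1 / cmin ^ 2) + 5 / 2 := by positivity
    exact this.trans_le (le_of_mul_le_mul_right h (hρ 0))
  have hlampos : ∀ t, 0 < lam t := fun t =>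
    lt_of_lt_of_le (mul_pos (by positivity) (mul_pos (hσε t) (hρ t))) (hlam t).1
  have hCLam : 0 < CLam :=
    pos_of_mul_pos_left ((hlampos 0).trans_le (hlam 0).2) (mul_pos (hσε 0) (hρ 0)).le
  refine ⟨fun t ω => oneStep_decomposition (hN t) _ _ _ _ _ _,
    fun t => condDistrib_noiseTerm (hX t).measurable (hε t) (hind t) _ (hΘm t), ?_, ?_⟩
  · intro hNk
    -- `144 / cmin` is `72 / c` at the curvature `c = cmin / 2`; `10 = 4 + 2 + 2 + 2` adds up the
    -- four bad events.
    refine isBigOInProb_of_measureReal_le hn (K := 144 / cmin * CLam * CMu) (C := 10)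
      (by positivity) (fun t =>
        ({ω | ¬ (1 ≤ μ t ∨ ClimeFeasible (sampleGram (X t ω)) (μ t) (S t)⁻¹)} ∪
          {ω | ∃ j, cmax + 4 * σx ^ 2 < sampleGram (X t ω) j j}) ∪
        ({ω | ∃ f : Fin ((R + 1) * s₂ t + 1) → Fin (n t) × Bool,
            signedSum f ⬝ᵥ sampleGram (X t ω) *ᵥ signedSum f <
              cmin / 2 * (signedSum f ⬝ᵥ signedSum f)} ∪
          {ω | ∃ j, N t * (lam t / 2) < |((X t ω)ᵀ *ᵥ ε t ω) j|})) ?_ ?_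
    · filter_upwards [hNk] with t ht
      have hs₂ : (1 : ℝ) ≤ s₂ t := by exact_mod_cast (hs0 t).2
      have hsl : Real.log (n t) ≤ s₂ t * Real.log (n t) := by
        nlinarith [hlog t]
      have hκl : (κ₀ + 5) * Real.log (n t) ≤ N t :=
        (mul_le_mul_of_nonneg_left hsl (by positivity)).trans ht
      have h5 : 5 * Real.log (n t) ≤ N t := by
        have := mul_pos hκ₀pos (hlog t)
        linarith
      have hn0 : 0 < n t := lt_of_lt_of_le two_pos (hn2 t)
      have e2 := (hX t).measureReal_diag hσx (hN t) hn0 (hsp t) (by linarith [hlog t])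
      have e3 := (hX t).measureReal_signedSum hσx (hN t) (hn2 t) (hsp t)
        (m := (R + 1) * s₂ t + 1) ht₀pos.le (min_le_left _ _) (min_le_right _ _) (by
          rw [le_div_iff₀ (by positivity)]
          have h1 : κ₀ * (s₂ t * Real.log (n t)) ≤ N t := by
            have := mul_pos (by linarith : (0 : ℝ) < s₂ t) (hlog t)
            linarith
          rw [hκ₀, div_mul_eq_mul_div, div_le_iff₀ (by positivity)] at h1
          refine le_trans ?_ h1
          have h2 : (2 * (((R + 1) * s₂ t + 1 : ℕ) : ℝ) + 1) ≤
              (2 * ((R + 1 : ℕ) + 1 : ℝ) + 1) * s₂ t := by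
            push_cast
            nlinarith
          calc _ = (2 * (((R + 1) * s₂ t + 1 : ℕ) : ℝ) + 1) *
                (Real.log (n t) * (32 * σx ^ 4)) := by ring
            _ ≤ (2 * ((R + 1 : ℕ) + 1 : ℝ) + 1) * s₂ t *
                (Real.log (n t) * (32 * σx ^ 4)) :=
              mul_le_mul_of_nonneg_right h2 (mul_nonneg (hlog t).le (by positivity))
            _ = _ := by ring)
      have e4 := (hX t).measureReal_noise_le hσx (hN t) hn0 (hσε t) (hε t) (hind t)
        (hlam t).1 h5
      refine (measureReal_union_le _ _).trans ((add_le_add (measureReal_union_le _ _)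
        (measureReal_union_le _ _)).trans ((add_le_add (add_le_add (hfeas t) e2)
        (add_le_add e3 e4)).trans_eq ?_))
      ring
    · intro t
      filter_upwards [hβ t, hclime t] with ω hβω hcl hgood
      simp only [Set.mem_union, Set.mem_ofPred_eq, not_or, not_exists, not_lt] at hgood
      obtain ⟨⟨g1, g2⟩, g3, g4⟩ := hgood
      rw [← not_or, not_not] at g1
      have hfe := (hcl g1).1
      have hs₁ : (0 : ℝ) < s₁ t := by exact_mod_cast (hs0 t).1
      have hl1 := hβω.l1_sub_le (hN t) (lt_of_lt_of_le two_pos (hd t)) (hlampos t) hν (hlamG t)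
        (hs0 t).2 (hl0 t).1 (hl0 t).2 ((le_div_iff₀ hs₁).1 (hs t)) g4 (c := cmin / 2)
        (C := |cmax| + 4 * σx ^ 2) (by positivity) (by positivity)
        (fun j => (g2 j).trans (by linarith [le_abs_self cmax])) (Nat.succ_pos R) hR' g3
      have hμ0 : 0 ≤ μ t := (matMax_nonneg _).trans hfe
      have hrem := vecMax_remainder_le (β := βhat t ω) (βstar := βstar t) (Real.sqrt_nonneg _) hμ0
        (diffOp_row_sum_le (G t) (hd t) k) hfe
      have hrpow : (2 * ((G t).maxDegree : ℝ)) ^ (((k : ℝ) + 1) / 2) =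
          √((2 * ((G t).maxDegree : ℝ)) ^ (k + 1)) := by
        rw [Real.sqrt_eq_rpow, ← Real.rpow_natCast, ← Real.rpow_mul (by positivity)]
        push_cast
        ring_nf
      rw [abs_of_nonneg (vecMax_nonneg _), hrpow]
      set r := √((2 * ((G t).maxDegree : ℝ)) ^ (k + 1))
      set ρ := √(Real.log (n t) / N t) with hρdef
      have hρ2 : √(N t : ℝ) * (ρ * ρ) = Real.log (n t) / √(N t : ℝ) := by
        rw [hρdef, Real.mul_self_sqrt (div_nonneg (hlog t).le (hNpos t).le)]
        nth_rewrite 2 [← Real.mul_self_sqrt (hNpos t).le]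
        have := Real.sqrt_pos.2 (hNpos t)
        field_simp
      have hl1' : l1 (βhat t ω - βstar t) ≤ 144 / cmin * (CLam * (σε t * ρ)) * s₂ t := by
        refine hl1.trans ?_
        calc _ = 144 / cmin * lam t * s₂ t := by ring
          _ ≤ _ := by
            gcongr
            exact (hlam t).2
      refine hrem.trans ?_
      calc √(N t : ℝ) * (r * μ t * l1 (βhat t ω - βstar t))
          ≤ √(N t : ℝ) * (r * (CMu * ρ) * (144 / cmin * (CLam * (σε t * ρ)) * s₂ t)) := by
            have := (hμ t).2
            have := l1_nonneg (βhat t ω - βstar t)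
            have := (hρ t).le
            gcongr
        _ = 144 / cmin * CLam * CMu * (σε t * r * (s₂ t * (√(N t : ℝ) * (ρ * ρ)))) := by ring
        _ = _ := by rw [hρ2]; ring
  · refine isBigOInProb_of_measureReal_le hn (K := 3 * CMu) (C := 4) (by positivity)
      (fun t => {ω | ¬ (1 ≤ μ t ∨ ClimeFeasible (sampleGram (X t ω)) (μ t) (S t)⁻¹)})
      (Eventually.of_forall hfeas) ?_
    intro t
    filter_upwards [hclime t] with ω hcl hgood
    simp only [not_not] at hgood
    have hT : ((S t)⁻¹)ᵀ = (S t)⁻¹ := by rw [transpose_nonsing_inv, hST]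
    rw [abs_of_nonneg (matMax_nonneg _)]
    refine ((hcl hgood).matMax_sandwich_sub_le (Real.sqrt_nonneg _)
      (diffOp_row_sum_le (G t) (hd t) k) hT (hM t) (hMnn t) hgood).trans ?_
    rw [Real.sq_sqrt (by positivity)]
    calc _ ≤ (2 * ((G t).maxDegree : ℝ)) ^ (k + 1) *
          (3 * (CMu * √(Real.log (n t) / N t) * M t)) := by
          have := (hμ t).2
          have := hMnn t
          gcongr
      _ = _ := by ring
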